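/- **Setting.** Let $K/k$ be a totally ramified finite Galois extension of complete discrete valuation fields with group $G$, whose degree $n=[K:k]$ is a power of $p$, where $p>0$ is the characteristic of the residue field. Let $\mathfrak O_K$ be the ring of integers of $K$, $\mathfrak M$ its maximal ideal, $v$ the normalized valuation of $K$, $\pi$ a uniformizer of $K$, $r:\mathfrak O_K\to F=\mathfrak O_K/\mathfrak M$ the residue map, and $d=v(\mathfrak D_{K/k})-n+1$, where $\mathfrak D_{K/k}$ is the different. The group algebra $K[G]$ acts on $K$ by $(\sum_\sigma a_\sigma\sigma)(x)=\sum_\sigma a_\sigma\sigma(x)$. For $i\in\mathbb Z$ put $$\mathfrak C_i=\{f\in K[G]: v(f(x))\ge v(x)+i\ \text{ for all } x\in K^*\},\qquad \mathfrak A_i=\mathfrak C_i\cap k[G].$$ For $0\ne f\in K[G]$ let $d(f)$ be the integer with $f\in\mathfrak C_{d(f)+d}\setminus\mathfrak C_{d(f)+d+1}$. Let $R=F[X]/(X^n-1)$, and for $f\in\mathfrak C_i$ let $$p_i(f)=r\bigl(\mathrm{Tr}_{K/k}(\pi^{-d})\bigr)^{-1}\sum_{j=0}^{n-1}r\bigl(f(\pi^{j-i})/\pi^j\bigr)X^j\in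 R .$$ For $0\neq f\in K[G]$ the leading term of $f$ is $\mathfrak p(f)=p_{d(f)+d}(f)$. For $g,g'\in R$ write $g\sim g'$ if $g=cg'$ for some $c\in F^*$. A set $B\subset K[G]\setminus\{0\}$ is *graded-independent* if for every $s\in\mathbb Z$ the family $(\mathfrak p(f))_{f\in B_s}$ is linearly independent over $F$, where $B_s=\{f\in B: d(f)\equiv s \bmod n\}$. For $1\ne\sigma\in G$ let $h(\sigma)$ be its lower ramification jump, i.e. the largest $i$ with $v(\sigma(x)-x)\ge i+1$ for all $x\in\mathfrak O_K$. **Theorem.** All the numbers $h(\sigma)$, $1\neq\sigma\in G$, are congruent modulo $p$. Let $\bar h\in\{0,\dots,p-1\}$ be their common residue ($\bar h=0$ if $n=1$). Let $a\ge 0$ and let $\sigma_1,\dots,\sigma_a\in G\setminus\{1\}$ be not necessarily distinct; put $\Sigma=\sum_{i=1}^a h(\sigma_i)$ and $\Pi=(\sigma_1-1)(\sigma_2-1)\cdots(\sigma_a-1)\in k[G]$. 1. $\Pi\in\mathfrak A_\Sigma$ and $p_\Sigma(\Pi)\sim\sum_{j=0}^{n-1}\Bigl(\prod_{l=1}^a(j-l\bar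 h)\Bigr)X^j$. 2. If $a<p$, then in $R$ we have $(X-1)^{n-a-1}\mid p_\Sigma(\Pi)$ and $(X-1)^{n-a}\nmid p_\Sigma(\Pi)$; moreover $\Pi\ne0$ and $d(\Pi)=\Sigma-d$. If in addition $\bar h\ne0$, then $p_\Sigma(\Pi)\sim(X^{-\bar h}-1)^{n-a-1}$ (note that $X$ is invertible in $R$). 3. Suppose that $p^a\le n$, $\bar h\neq0$, and for every $1\le i\le a-1$ we have $h(\sigma_{i+1})-h(\sigma_i)=p^is_i$ with $s_i\in\mathbb Z\setminus p\mathbb Z$. Let $B$ be the set of the products $(\sigma_1-1)^{n_1}\cdots(\sigma_a-1)^{n_a}$, where $(n_i)$ runs through the $a$-tuples of non-negative integers with $\sum n_i<p$. Then for every $s\in\mathbb Z$ the set $B_s$ has at most one element, and $B$ is graded-independent. -/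

import Mathlib

open Polynomial IsLocalRing

namespace AssocGalois

noncomputable section

/-!
Setting: `O ⊆ k` is the complete discrete valuation ring of the base field `k`, `K/k` is a finite
Galois extension with group `Gal(K/k)`, and `OK ⊆ K` is the ring of integers of `K`.
-/

/-- The normalized discrete valuation of `K` in Mathlib's multiplicative notation: `val OK x` is
`exp (-v(x))` for `x ≠ 0`, and `val OK 0 = 0`. -/
def val (OK : Type*) {K : Type*} [CommRing OK] [IsDomain OK] [IsDiscreteValuationRing OK]
    [Field K] [Algebra OK K] [IsFractionRing OK K] : Valuation K (WithZero (Multiplicative ℤ)) :=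
  (IsDiscreteValuationRing.maximalIdeal OK).valuation K

/-- `ValGE OK i x` says that `v(x) ≥ i` (in particular it holds for `x = 0`). -/
def ValGE (OK : Type*) {K : Type*} [CommRing OK] [IsDomain OK] [IsDiscreteValuationRing OK]
    [Field K] [Algebra OK K] [IsFractionRing OK K] (i : ℤ) (x : K) : Prop :=
  val OK x ≤ WithZero.exp (-i)

open Classical in
/-- The residue map `r : OK → OK / m`, extended by `0` to the elements of `K` outside `OK`. -/
def res (OK : Type*) {K : Type*} [CommRing OK] [IsDomain OK] [IsDiscreteValuationRing OK]
    [Field K] [Algebra OK K] (x : K) : ResidueField OK :=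
  if h : ∃ y : OK, algebraMap OK K y = x then residue OK h.choose else 0

/-- `K/k` is totally ramified: the maximal ideal of `O` generates the `n`-th power of the
maximal ideal of `OK`, where `n = [K : k]`. -/
def TotallyRamified (O OK k K : Type*) [CommRing O] [IsLocalRing O] [CommRing OK] [IsLocalRing OK]
    [Algebra O OK] [Field k] [Field K] [Algebra k K] : Prop :=
  (maximalIdeal O).map (algebraMap O OK) = maximalIdeal OK ^ Module.finrank k K

/-- The set `G_i = {σ ∈ G : v(σ(x) - x) ≥ i + 1 for all x ∈ OK}`, the `i`-th ramification group in
lower numbering. -/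
def ramGroup (OK : Type*) {k K : Type*} [CommRing OK] [IsDomain OK] [IsDiscreteValuationRing OK]
    [Field k] [Field K] [Algebra k K] [Algebra OK K] [IsFractionRing OK K] (i : ℕ) :
    Set Gal(K/k) :=
  {σ | ∀ x : OK, ValGE OK ((i : ℤ) + 1) (σ (algebraMap OK K x) - algebraMap OK K x)}

/-- The (lower) ramification jump `h(σ)` of `σ ≠ 1`: the largest `i` with `σ ∈ G_i`. -/
def jump (OK : Type*) {k K : Type*} [CommRing OK] [IsDomain OK] [IsDiscreteValuationRing OK]
    [Field k] [Field K] [Algebra k K] [Algebra OK K] [IsFractionRing OK K] (σ : Gal(K/k)) : ℕ :=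
  sSup {i : ℕ | σ ∈ ramGroup OK i}

/-- The residue modulo `p` of the smallest ramification jump of `K/k` (and `0` if `K = k`). -/
def jumpResidue (OK k K : Type*) [CommRing OK] [IsDomain OK] [IsDiscreteValuationRing OK]
    [Field k] [Field K] [Algebra k K] [Algebra OK K] [IsFractionRing OK K] (p : ℕ) : ℕ :=
  sInf {h : ℕ | ∃ σ : Gal(K/k), σ ≠ 1 ∧ jump OK σ = h} % p

/-- The ramification depth `d = v(D) - n + 1`, where `D` is the different of `K/k`. -/
def ramDepth (O OK k K : Type*) [CommRing O] [IsDomain O] [IsDiscreteValuationRing O]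
    [CommRing OK] [IsDomain OK] [IsDiscreteValuationRing OK] [Algebra O OK]
    [Module.IsTorsionFree O OK] [Field k] [Field K] [Algebra k K] : ℤ :=
  (multiplicity (maximalIdeal OK) (differentIdeal O OK) : ℤ) - (Module.finrank k K : ℤ) + 1

/-- The action of `K[G]` on `K`: `(∑ a_σ σ)(x) = ∑ a_σ σ(x)`. -/
def act {k K : Type*} [Field k] [Field K] [Algebra k K] (f : MonoidAlgebra K Gal(K/k)) (x : K) :
    K :=
  f.coeff.sum fun σ a => a * σ x

/-- The inclusion `k[G] → K[G]`. -/
def incl (k K : Type*) [Field k] [Field K] [Algebra k K] :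
    MonoidAlgebra k Gal(K/k) →+* MonoidAlgebra K Gal(K/k) :=
  MonoidAlgebra.mapRingHom Gal(K/k) (algebraMap k K)

/-- `C_i`: the `f ∈ K[G]` such that `v(f(x)) ≥ v(x) + i` for all `x`. -/
def modC (OK k K : Type*) [CommRing OK] [IsDomain OK] [IsDiscreteValuationRing OK]
    [Field k] [Field K] [Algebra k K] [Algebra OK K] [IsFractionRing OK K] (i : ℤ) :
    Set (MonoidAlgebra K Gal(K/k)) :=
  {f | ∀ x : K, val OK (act f x) ≤ WithZero.exp (-i) * val OK x}

/-- The associated Galois module `A_i = C_i ∩ k[G]`. -/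
def modA (OK k K : Type*) [CommRing OK] [IsDomain OK] [IsDiscreteValuationRing OK]
    [Field k] [Field K] [Algebra k K] [Algebra OK K] [IsFractionRing OK K] (i : ℤ) :
    Set (MonoidAlgebra k Gal(K/k)) :=
  {f | incl k K f ∈ modC OK k K i}

/-- For `f ≠ 0`: the largest `i` with `f ∈ C_i`. -/
def level {OK k K : Type*} [CommRing OK] [IsDomain OK] [IsDiscreteValuationRing OK]
    [Field k] [Field K] [Algebra k K] [Algebra OK K] [IsFractionRing OK K]
    (f : MonoidAlgebra K Gal(K/k)) : ℤ :=
  sSup {i : ℤ | f ∈ modC OK k K i}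

/-- The function `d(f)` on `K[G] \ {0}`: `d(f) = i` if `f ∈ C_(i+d)` and `f ∉ C_(i+d+1)`. -/
def dfun (O OK : Type*) {k K : Type*} [CommRing O] [IsDomain O] [IsDiscreteValuationRing O]
    [CommRing OK] [IsDomain OK] [IsDiscreteValuationRing OK] [Algebra O OK]
    [Module.IsTorsionFree O OK]
    [Field k] [Field K] [Algebra k K] [Algebra OK K] [IsFractionRing OK K]
    (f : MonoidAlgebra K Gal(K/k)) : ℤ :=
  level (OK := OK) f - ramDepth O OK k K

/-- The ring `R = F[X] / (X^n - 1)`, where `F` is the residue field and `n = [K : k]`. -/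
abbrev RR (OK k K : Type*) [CommRing OK] [IsLocalRing OK] [Field k] [Field K] [Algebra k K] :
    Type _ :=
  AdjoinRoot ((X : (ResidueField OK)[X]) ^ Module.finrank k K - 1)

/-- The class of `X` in `R`. -/
abbrev XX (OK k K : Type*) [CommRing OK] [IsLocalRing OK] [Field k] [Field K] [Algebra k K] :
    RR OK k K :=
  AdjoinRoot.root _

/-- `p_i(f) = r(tr(π^(-d)))⁻¹ ∑_{j < n} r(f(π^(j-i)) / π^j) X^j ∈ R`, for `f ∈ C_i`. -/
def pmap (O : Type*) {OK k K : Type*} [CommRing O] [IsDomain O] [IsDiscreteValuationRing O]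
    [CommRing OK] [IsDomain OK] [IsDiscreteValuationRing OK] [Algebra O OK]
    [Module.IsTorsionFree O OK]
    [Field k] [Field K] [Algebra k K] [Algebra OK K]
    (ϖ : OK) (i : ℤ) (f : MonoidAlgebra K Gal(K/k)) : RR OK k K :=
  (res OK (algebraMap k K (Algebra.trace k K
      ((algebraMap OK K ϖ) ^ (-(ramDepth O OK k K))))))⁻¹ •
    ∑ j ∈ Finset.range (Module.finrank k K),
      res OK (act f ((algebraMap OK K ϖ) ^ ((j : ℤ) - i)) / (algebraMap OK K ϖ) ^ j) •
        XX OK k K ^ j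

/-- The leading term `p_i(f)`, `f ∈ C_i \ C_(i+1)`, of a nonzero `f ∈ K[G]`. -/
def lead (O : Type*) {OK k K : Type*} [CommRing O] [IsDomain O] [IsDiscreteValuationRing O]
    [CommRing OK] [IsDomain OK] [IsDiscreteValuationRing OK] [Algebra O OK]
    [Module.IsTorsionFree O OK]
    [Field k] [Field K] [Algebra k K] [Algebra OK K] [IsFractionRing OK K]
    (ϖ : OK) (f : MonoidAlgebra K Gal(K/k)) : RR OK k K :=
  pmap O ϖ (level (OK := OK) f) f

/-- `g ∼ g'` in `R`: equality up to a nonzero scalar from the residue field. -/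
def SimR {OK k K : Type*} [CommRing OK] [IsLocalRing OK] [Field k] [Field K] [Algebra k K]
    (g g' : RR OK k K) : Prop :=
  ∃ c : ResidueField OK, c ≠ 0 ∧ g = c • g'

/-- `B_s = {f ∈ B : d(f) ≡ s mod n}`. -/
def slice (O OK : Type*) {k K : Type*} [CommRing O] [IsDomain O] [IsDiscreteValuationRing O]
    [CommRing OK] [IsDomain OK] [IsDiscreteValuationRing OK] [Algebra O OK]
    [Module.IsTorsionFree O OK]
    [Field k] [Field K] [Algebra k K] [Algebra OK K] [IsFractionRing OK K]
    (B : Set (MonoidAlgebra K Gal(K/k))) (s : ℤ) : Set (MonoidAlgebra K Gal(K/k)) :=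
  {f ∈ B | dfun O OK f ≡ s [ZMOD (Module.finrank k K : ℤ)]}

/-- `B ⊆ K[G] \ {0}` is graded-independent: for every `s` the leading terms of the elements of
`B_s` are linearly independent over the residue field. -/
def GradedIndependent (O : Type*) {OK k K : Type*} [CommRing O] [IsDomain O]
    [IsDiscreteValuationRing O]
    [CommRing OK] [IsDomain OK] [IsDiscreteValuationRing OK] [Algebra O OK]
    [Module.IsTorsionFree O OK]
    [Field k] [Field K] [Algebra k K] [Algebra OK K] [IsFractionRing OK K]
    (ϖ : OK) (B : Set (MonoidAlgebra K Gal(K/k))) : Prop :=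
  (0 : MonoidAlgebra K Gal(K/k)) ∉ B ∧
    ∀ s : ℤ, LinearIndependent (ResidueField OK)
      (fun f : slice O OK B s => (lead O ϖ (f : MonoidAlgebra K Gal(K/k)) : RR OK k K))

/-- The ordered product `(σ_1 - 1)^(m_1) ⋯ (σ_a - 1)^(m_a)` in `k[G]`. -/
def prodPow {k K : Type*} [Field k] [Field K] [Algebra k K] {a : ℕ} (σ : Fin a → Gal(K/k))
    (m : Fin a → ℕ) : MonoidAlgebra k Gal(K/k) :=
  (List.ofFn fun i => (MonoidAlgebra.of k Gal(K/k) (σ i) - 1) ^ m i).prod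

/-- The ordered product `(σ_1 - 1) ⋯ (σ_a - 1)` in `k[G]`. -/
def prodSub {k K : Type*} [Field k] [Field K] [Algebra k K] {a : ℕ} (σ : Fin a → Gal(K/k)) :
    MonoidAlgebra k Gal(K/k) :=
  (List.ofFn fun i => MonoidAlgebra.of k Gal(K/k) (σ i) - 1).prod

end

end AssocGalois

/-! Total ramification makes the residue fields agree (`residueRep`), so an element of valuation at
least i is a π^i up to higher valuation, with a integral in k. A k-linear operator raising
valuations by at least h is therefore governed to leading order by its coefficients φ(j) on the
powers π^j (`HasLead`). Composition multiplies such coefficients after an index shift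
(`HasLead.mul`).

For σ ≠ 1 write σπ = π(1 + ε). The p-power degree forces v(ε) ≥ 1, and then h(σ) = v(ε). Since (1 +
ε)^j - 1 is jε to first order, σ - 1 has shift h(σ) and coefficients φ(j) = jc with c ≠ 0. Let t
have the largest jump. Comparing (s - 1)(t - 1) with (t - 1)(s - 1) gives h(s) = h(t) in F, because
a nontrivial commutator would have a larger jump. So all jumps agree mod p, and multiplying
coefficients gives the products of the j - l h̄ (`exists_hasLead_list_prod`). The trace constant in
p_i has nonzero residue by the choice of d (`res_trace_ne_zero`).

The resulting polynomial arises from (X^n - 1)/(X - 1) = (X - 1)^(n-1) by applying the operators X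
d/dX - l h̄. Each lowers the order of vanishing at 1 by exactly one, as long as fewer than p are
applied (`exists_coeffPoly_eq`). If h̄ ≠ 0, reindexing by j = -h̄ i turns the sum into an exact
power (`sum_prod_smul_pow_eq`).

For graded independence, the levels ∑ m_i h(σ_i) are pairwise distinct modulo p^a
(`eq_of_pow_dvd_sum`), hence modulo n. A slice then has at most one element, and its leading term is
nonzero. -/

set_option linter.unusedSectionVars false

namespace AssocGalois

/-! ### Valuation inequalities and the residue map on K. -/

section Valuation

variable {OK K : Type*} [CommRing OK] [IsDomain OK] [IsDiscreteValuationRing OK]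
    [Field K] [Algebra OK K] [IsFractionRing OK K]

lemma val_le_one_iff {x : K} : val OK x ≤ 1 ↔ ∃ y : OK, algebraMap OK K y = x := by
  refine ⟨fun h => IsDiscreteValuationRing.exists_lift_of_le_one h, ?_⟩
  rintro ⟨y, rfl⟩
  exact IsDedekindDomain.HeightOneSpectrum.valuation_le_one _ y

lemma val_uniformizer {ϖ : OK} (hϖ : Irreducible ϖ) :
    val OK (algebraMap OK K ϖ) = WithZero.exp (-1 : ℤ) := by
  rw [val, IsDedekindDomain.HeightOneSpectrum.valuation_of_algebraMap]
  apply IsDedekindDomain.HeightOneSpectrum.intValuation_singleton _ hϖ.ne_zero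
  exact (IsDiscreteValuationRing.irreducible_iff_uniformizer _).mp hϖ

lemma map_uniformizer_ne_zero {ϖ : OK} (hϖ : Irreducible ϖ) : algebraMap OK K ϖ ≠ 0 := by
  simpa using hϖ.ne_zero

lemma val_uniformizer_zpow {ϖ : OK} (hϖ : Irreducible ϖ) (i : ℤ) :
    val OK (algebraMap OK K ϖ ^ i) = WithZero.exp (-i : ℤ) := by
  rw [map_zpow₀, val_uniformizer hϖ, ← WithZero.exp_zsmul]
  simp

lemma valGE_iff {ϖ : OK} (hϖ : Irreducible ϖ) {i : ℤ} {x : K} :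
    ValGE OK i x ↔ ∃ y : OK, x = algebraMap OK K ϖ ^ i * algebraMap OK K y := by
  have h0 := map_uniformizer_ne_zero (K := K) hϖ
  have key : ValGE OK i x ↔ val OK (algebraMap OK K ϖ ^ (-i) * x) ≤ 1 := by
    rw [map_mul, val_uniformizer_zpow hϖ, neg_neg, ValGE, mul_comm,
      ← le_div_iff₀ (by simp), WithZero.exp_neg, one_div]
  rw [key, val_le_one_iff]
  refine exists_congr fun y => ?_
  rw [zpow_neg, eq_comm (a := algebraMap OK K y), inv_mul_eq_iff_eq_mul₀ (zpow_ne_zero _ h0)]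

lemma ValGE.zero (i : ℤ) : ValGE OK i (0 : K) := by simp [ValGE]

lemma ValGE.add {i : ℤ} {x y : K} (hx : ValGE OK i x) (hy : ValGE OK i y) :
    ValGE OK i (x + y) := Valuation.map_add_le _ hx hy

lemma ValGE.sub {i : ℤ} {x y : K} (hx : ValGE OK i x) (hy : ValGE OK i y) :
    ValGE OK i (x - y) := Valuation.map_sub_le _ hx hy

lemma ValGE.mul {i j : ℤ} {x y : K} (hx : ValGE OK i x) (hy : ValGE OK j y) :
    ValGE OK (i + j) (x * y) := by
  simp only [ValGE] at *
  rw [map_mul, neg_add, WithZero.exp_add]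
  exact mul_le_mul' hx hy

lemma ValGE.mono {i j : ℤ} {x : K} (hx : ValGE OK i x) (h : j ≤ i) : ValGE OK j x :=
  le_trans hx (WithZero.exp_le_exp.2 (by omega))

lemma valGE_zero_iff {x : K} : ValGE OK 0 x ↔ ∃ y : OK, algebraMap OK K y = x := by
  rw [← val_le_one_iff]; simp [ValGE]

lemma valGE_algebraMap (y : OK) : ValGE OK 0 (algebraMap OK K y) := valGE_zero_iff.2 ⟨y, rfl⟩

lemma valGE_uniformizer_zpow {ϖ : OK} (hϖ : Irreducible ϖ) (i : ℤ) :
    ValGE OK i (algebraMap OK K ϖ ^ i) := (val_uniformizer_zpow hϖ i).le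

lemma ValGE.div_zpow {ϖ : OK} (hϖ : Irreducible ϖ) {i j : ℤ} {x : K} (hx : ValGE OK i x) :
    ValGE OK (i - j) (x / algebraMap OK K ϖ ^ j) := by
  rw [div_eq_mul_inv, ← zpow_neg]
  exact hx.mul (valGE_uniformizer_zpow hϖ _)

lemma valGE_of_forall {x : K} (h : ∀ n : ℕ, ValGE OK n x) : x = 0 := by
  by_contra hx
  have hv : val OK x ≠ 0 := (Valuation.ne_zero_iff _).2 hx
  obtain ⟨n, hn⟩ : ∃ n : ℤ, val OK x = WithZero.exp n := ⟨_, (WithZero.exp_log hv).symm⟩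
  have := h (-n + 1).toNat
  simp only [ValGE, hn, WithZero.exp_le_exp] at this
  omega

lemma res_algebraMap (y : OK) : res OK (algebraMap OK K y) = residue OK y := by
  have h : ∃ z : OK, algebraMap OK K z = algebraMap OK K y := ⟨y, rfl⟩
  rw [res, dif_pos h]
  congr 1
  exact IsFractionRing.injective OK K h.choose_spec

lemma res_zero : res OK (0 : K) = 0 := by simpa using res_algebraMap (K := K) (0 : OK)

lemma res_one : res OK (1 : K) = 1 := by simpa using res_algebraMap (K := K) (1 : OK)

lemma res_add {x y : K} (hx : ValGE OK 0 x) (hy : ValGE OK 0 y) :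
    res OK (x + y) = res OK x + res OK y := by
  obtain ⟨x, rfl⟩ := valGE_zero_iff.1 hx
  obtain ⟨y, rfl⟩ := valGE_zero_iff.1 hy
  rw [← map_add, res_algebraMap, res_algebraMap, res_algebraMap, map_add]

lemma res_sub {x y : K} (hx : ValGE OK 0 x) (hy : ValGE OK 0 y) :
    res OK (x - y) = res OK x - res OK y := by
  obtain ⟨x, rfl⟩ := valGE_zero_iff.1 hx
  obtain ⟨y, rfl⟩ := valGE_zero_iff.1 hy
  rw [← map_sub, res_algebraMap, res_algebraMap, res_algebraMap, map_sub]

lemma res_mul {x y : K} (hx : ValGE OK 0 x) (hy : ValGE OK 0 y) :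
    res OK (x * y) = res OK x * res OK y := by
  obtain ⟨x, rfl⟩ := valGE_zero_iff.1 hx
  obtain ⟨y, rfl⟩ := valGE_zero_iff.1 hy
  rw [← map_mul, res_algebraMap, res_algebraMap, res_algebraMap, map_mul]

lemma res_eq_zero_iff {x : K} (hx : ValGE OK 0 x) : res OK x = 0 ↔ ValGE OK 1 x := by
  obtain ⟨ϖ, hϖ⟩ := IsDiscreteValuationRing.exists_irreducible OK
  obtain ⟨x, rfl⟩ := valGE_zero_iff.1 hx
  rw [res_algebraMap, residue_eq_zero_iff, (IsDiscreteValuationRing.irreducible_iff_uniformizer _).mp hϖ,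
    Ideal.mem_span_singleton, valGE_iff hϖ]
  refine exists_congr fun c => ?_
  rw [zpow_one, ← map_mul, (IsFractionRing.injective OK K).eq_iff]

lemma ValGE.res_eq_zero {x : K} (hx : ValGE OK 1 x) : res OK x = 0 :=
  (res_eq_zero_iff (hx.mono (by norm_num))).2 hx

lemma res_intCast (n : ℤ) : res OK (n : K) = (n : ResidueField OK) := by
  simpa using res_algebraMap (K := K) (n : OK)

lemma valGE_intCast (n : ℤ) : ValGE OK 0 (n : K) := by
  simpa using valGE_algebraMap (K := K) (n : OK)

end Valuation

/-! ### Galois invariance of the valuation and equality of residue fields. -/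

section Extension

variable {O OK k K : Type*}
    [CommRing O] [IsDomain O] [IsDiscreteValuationRing O]
    [CommRing OK] [IsDomain OK] [IsDiscreteValuationRing OK]
    [Field k] [Field K] [Algebra O k] [IsFractionRing O k] [Algebra OK K] [IsFractionRing OK K]
    [Algebra k K] [FiniteDimensional k K] [IsGalois k K]
    [Algebra O OK] [Algebra O K] [IsScalarTower O OK K] [IsScalarTower O k K]
    [IsIntegralClosure OK O K] [Module.IsTorsionFree O OK]

/-- Every element of `OK` is congruent modulo the maximal ideal to an integral element of `k`. -/
def ResidueRep (OK k K : Type*) [CommRing OK] [IsDomain OK] [IsDiscreteValuationRing OK]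
    [Field k] [Field K] [Algebra k K] [Algebra OK K] [IsFractionRing OK K] : Prop :=
  ∀ y : OK, ∃ a : k, ValGE OK 0 (algebraMap k K a) ∧
    ValGE OK 1 (algebraMap OK K y - algebraMap k K a)

/-- The Galois group acts on `K` by isometries. -/
def GaloisIsometric (OK k K : Type*) [CommRing OK] [IsDomain OK] [IsDiscreteValuationRing OK]
    [Field k] [Field K] [Algebra k K] [Algebra OK K] [IsFractionRing OK K] : Prop :=
  ∀ (σ : Gal(K/k)) (i : ℤ) (x : K), ValGE OK i x → ValGE OK i (σ x)

include O in
variable (O OK k K) in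
-- σ restricts to an automorphism of `OK`, so it carries a uniformizer to a uniformizer, and
-- `valGE_iff` may be used with either one.
lemma galoisIsometric : GaloisIsometric OK k K := by
  intro σ i x hx
  obtain ⟨ϖ, hϖ⟩ := IsDiscreteValuationRing.exists_irreducible OK
  let e := galRestrict O k K OK σ
  have he : ∀ y, algebraMap OK K (e y) = σ (algebraMap OK K y) :=
    fun y => algebraMap_galRestrict_apply O σ y
  have hirr : Irreducible (e ϖ) := (MulEquiv.irreducible_iff e).2 hϖ
  obtain ⟨y, rfl⟩ := (valGE_iff hϖ).1 hx
  refine (valGE_iff hirr).2 ⟨e y, ?_⟩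
  rw [map_mul, map_zpow₀, he, he]

include k K in
variable (O OK k K) in
lemma finite_integralClosure : Module.Finite O OK := IsIntegralClosure.finite O k K OK

variable (O OK k K) in
-- In ef = n, total ramification says e = n. Hence f = 1 and the residue fields coincide.
lemma exists_residue_eq (hram : TotallyRamified O OK k K) (y : OK) :
    ∃ a : O, y - algebraMap O OK a ∈ maximalIdeal OK := by
  have : Module.Finite O OK := finite_integralClosure O OK k K
  have hp0 : maximalIdeal O ≠ ⊥ := IsDiscreteValuationRing.not_a_field O
  have h1 := Ideal.ramificationIdx_mul_inertiaDeg_of_isLocalRing (S := OK) k K hp0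
  have h2 : Ideal.ramificationIdx' (maximalIdeal O) (maximalIdeal OK) = Module.finrank k K := by
    apply Ideal.ramificationIdx'_spec
    · exact hram.le
    · rw [hram]
      intro h
      exact absurd h (Ideal.pow_succ_lt_pow (IsDiscreteValuationRing.not_a_field OK) _).not_ge
  have hlo : (maximalIdeal OK).LiesOver (maximalIdeal O) := inferInstance
  have hn : 0 < Module.finrank k K := Module.finrank_pos
  rw [h2, Ideal.inertiaDeg'_algebraMap] at h1
  have h3 : Module.finrank (O ⧸ maximalIdeal O) (OK ⧸ maximalIdeal OK) = 1 :=
    Nat.eq_of_mul_eq_mul_left hn (by rw [h1, mul_one])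
  let _ : Field (O ⧸ maximalIdeal O) := Ideal.Quotient.field _
  obtain ⟨c, hc⟩ := (finrank_eq_one_iff_of_nonzero' (1 : OK ⧸ maximalIdeal OK) one_ne_zero).1 h3
    (Ideal.Quotient.mk _ y)
  obtain ⟨a, rfl⟩ := Ideal.Quotient.mk_surjective c
  refine ⟨a, ?_⟩
  rw [← Ideal.Quotient.eq, ← hc, Algebra.smul_def, mul_one]
  rfl

lemma residueRep (hram : TotallyRamified O OK k K) : ResidueRep OK k K := by
  intro y
  obtain ⟨a, ha⟩ := exists_residue_eq O OK k K hram y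
  refine ⟨algebraMap O k a, ?_, ?_⟩
  · rw [← IsScalarTower.algebraMap_apply O k K, IsScalarTower.algebraMap_apply O OK K]
    exact valGE_algebraMap _
  · rw [← IsScalarTower.algebraMap_apply O k K, IsScalarTower.algebraMap_apply O OK K, ← map_sub,
      ← res_eq_zero_iff (valGE_algebraMap _), res_algebraMap, residue_eq_zero_iff]
    exact ha

end Extension

/-! ### Approximation by k-multiples of powers of the uniformizer. -/

section Approximation

variable {OK k K : Type*} [CommRing OK] [IsDomain OK] [IsDiscreteValuationRing OK]
    [Field k] [Field K] [Algebra k K] [Algebra OK K] [IsFractionRing OK K]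

lemma ResidueRep.exists_res_eq (hR : ResidueRep OK k K) (c : ResidueField OK) :
    ∃ a : k, ValGE OK 0 (algebraMap k K a) ∧ res OK (algebraMap k K a) = c := by
  obtain ⟨y, rfl⟩ := residue_surjective c
  obtain ⟨a, ha, h⟩ := hR y
  refine ⟨a, ha, ?_⟩
  have := h.res_eq_zero
  rw [res_sub (valGE_algebraMap _) ha, sub_eq_zero, res_algebraMap] at this
  exact this.symm

/-- An element of valuation at least `j` is, up to higher valuation, a multiple of `ϖ ^ j` by any
integral element of `k` with the right residue. -/
lemma valGE_sub_mul_zpow {ϖ : OK} (hϖ : Irreducible ϖ) {j : ℤ} {x : K} (hx : ValGE OK j x) {a : k}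
    (ha : ValGE OK 0 (algebraMap k K a))
    (h : res OK (algebraMap k K a) = res OK (x / algebraMap OK K ϖ ^ j)) :
    ValGE OK (j + 1) (x - algebraMap k K a * algebraMap OK K ϖ ^ j) := by
  have h0 := zpow_ne_zero j (map_uniformizer_ne_zero (K := K) hϖ)
  have hd : ValGE OK 0 (x / algebraMap OK K ϖ ^ j) := by simpa using hx.div_zpow hϖ (j := j)
  have h1 : ValGE OK 1 (x / algebraMap OK K ϖ ^ j - algebraMap k K a) := by
    rw [← res_eq_zero_iff (hd.sub ha), res_sub hd ha, h, sub_self]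
  have h2 := (valGE_uniformizer_zpow (K := K) hϖ j).mul h1
  rwa [mul_sub, mul_div_cancel₀ _ h0, mul_comm _ (algebraMap k K a)] at h2

lemma ResidueRep.exists_approx (hR : ResidueRep OK k K) {ϖ : OK} (hϖ : Irreducible ϖ) {j : ℤ}
    {x : K} (hx : ValGE OK j x) :
    ∃ a : k, ValGE OK 0 (algebraMap k K a) ∧
      ValGE OK (j + 1) (x - algebraMap k K a * algebraMap OK K ϖ ^ j) := by
  obtain ⟨a, ha, h⟩ := hR.exists_res_eq (res OK (x / algebraMap OK K ϖ ^ j))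
  exact ⟨a, ha, valGE_sub_mul_zpow hϖ hx ha h⟩

end Approximation

/-! ### Calculus of leading coefficients of k-linear operators. -/

section Lead

variable {OK k K : Type*} [CommRing OK] [IsDomain OK] [IsDiscreteValuationRing OK]
    [Field k] [Field K] [Algebra k K] [Algebra OK K] [IsFractionRing OK K]

lemma exists_valGE_not_succ {x : K} (hx : x ≠ 0) : ∃ i : ℤ, ValGE OK i x ∧ ¬ ValGE OK (i + 1) x := by
  have hv : val OK x ≠ 0 := (Valuation.ne_zero_iff _).2 hx
  refine ⟨-WithZero.log (val OK x), ?_, ?_⟩ <;>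
  · rw [ValGE, ← WithZero.exp_log hv, WithZero.exp_le_exp, WithZero.log_exp]
    omega

lemma exists_valGE (x : K) : ∃ i : ℤ, ValGE OK i x := by
  by_cases hx : x = 0
  · exact ⟨0, hx ▸ ValGE.zero 0⟩
  · exact (exists_valGE_not_succ hx).imp fun _ h => h.1

/-- The `k`-linear map `f` raises valuations by at least `h`, and `f (ϖ ^ j)` has leading
coefficient `φ j` in degree `j + h`. -/
structure HasLead (ϖ : OK) (f : Module.End k K) (h : ℤ) (φ : ℤ → ResidueField OK) : Prop where
  valGE : ∀ (i : ℤ) (x : K), ValGE OK i x → ValGE OK (i + h) (f x)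
  res_eq : ∀ j : ℤ, res OK (f (algebraMap OK K ϖ ^ j) / algebraMap OK K ϖ ^ (j + h)) = φ j

variable {ϖ : OK}

lemma valGE_zero_div (hϖ : Irreducible ϖ) {i : ℤ} {x : K} (hx : ValGE OK i x) :
    ValGE OK 0 (x / algebraMap OK K ϖ ^ i) := by simpa using hx.div_zpow hϖ (j := i)

lemma res_div_eq_zero_iff (hϖ : Irreducible ϖ) {i : ℤ} {x : K} (hx : ValGE OK i x) :
    res OK (x / algebraMap OK K ϖ ^ i) = 0 ↔ ValGE OK (i + 1) x := by
  have h0 := zpow_ne_zero i (map_uniformizer_ne_zero (K := K) hϖ)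
  rw [res_eq_zero_iff (valGE_zero_div hϖ hx)]
  refine ⟨fun h => ?_, fun h => by simpa using h.div_zpow hϖ (j := i)⟩
  have := (valGE_uniformizer_zpow (K := K) hϖ i).mul h
  rwa [mul_div_cancel₀ _ h0] at this

/-- Replacing x by its leading term aϖ^j changes f x only beyond degree j + h, and a, lying in k,
can be pulled out of f. -/
lemma HasLead.res_apply (hR : ResidueRep OK k K) (hϖ : Irreducible ϖ) {f : Module.End k K} {h : ℤ}
    {φ : ℤ → ResidueField OK} (hf : HasLead ϖ f h φ) {j : ℤ} {x : K} (hx : ValGE OK j x) :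
    res OK (f x / algebraMap OK K ϖ ^ (j + h)) = res OK (x / algebraMap OK K ϖ ^ j) * φ j := by
  obtain ⟨a, ha, h1⟩ := hR.exists_res_eq (res OK (x / algebraMap OK K ϖ ^ j))
  have h2 := hf.valGE _ _ (valGE_sub_mul_zpow hϖ hx ha h1)
  have e : f x = algebraMap k K a * f (algebraMap OK K ϖ ^ j) +
      f (x - algebraMap k K a * algebraMap OK K ϖ ^ j) := by
    rw [map_sub, ← Algebra.smul_def, ← Algebra.smul_def, map_smul]; abel
  have h3 := valGE_zero_div hϖ (hf.valGE _ _ (valGE_uniformizer_zpow (K := K) hϖ j))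
  have h4 : ValGE OK 1 (f (x - algebraMap k K a * algebraMap OK K ϖ ^ j) /
      algebraMap OK K ϖ ^ (j + h)) := by
    have := h2.div_zpow hϖ (j := j + h)
    rwa [show j + 1 + h - (j + h) = 1 by ring] at this
  rw [e, add_div, mul_div_assoc, res_add (by simpa using ha.mul h3) (h4.mono zero_le_one),
    h4.res_eq_zero, add_zero, res_mul ha h3, h1, hf.res_eq]

/-- The map g acts first, so f meets an element whose leading degree has already moved to j + h'. -/
lemma HasLead.mul (hR : ResidueRep OK k K) (hϖ : Irreducible ϖ) {f g : Module.End k K} {h h' : ℤ}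
    {φ ψ : ℤ → ResidueField OK} (hf : HasLead ϖ f h φ) (hg : HasLead ϖ g h' ψ) :
    HasLead ϖ (f * g) (h' + h) fun j => ψ j * φ (j + h') where
  valGE i x hx := by
    rw [← add_assoc]
    exact hf.valGE _ _ (hg.valGE _ _ hx)
  res_eq j := by
    rw [← add_assoc, Module.End.mul_apply,
      hf.res_apply hR hϖ (hg.valGE _ _ (valGE_uniformizer_zpow hϖ j)), hg.res_eq]

lemma HasLead.sub (hϖ : Irreducible ϖ) {f g : Module.End k K} {h : ℤ}
    {φ ψ : ℤ → ResidueField OK} (hf : HasLead ϖ f h φ) (hg : HasLead ϖ g h ψ) :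
    HasLead ϖ (f - g) h fun j => φ j - ψ j where
  valGE i x hx := (hf.valGE _ _ hx).sub (hg.valGE _ _ hx)
  res_eq j := by
    have hj := valGE_uniformizer_zpow (K := K) hϖ j
    rw [LinearMap.sub_apply, sub_div, res_sub (valGE_zero_div hϖ (hf.valGE _ _ hj))
      (valGE_zero_div hϖ (hg.valGE _ _ hj)), hf.res_eq, hg.res_eq]

lemma HasLead.one (hϖ : Irreducible ϖ) :
    HasLead ϖ (1 : Module.End k K) 0 fun _ => 1 where
  valGE i x hx := by simpa using hx
  res_eq j := by
    have h0 := zpow_ne_zero j (map_uniformizer_ne_zero (K := K) hϖ)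
    simp [div_self h0, res_one]

end Lead

/-! ### Leading coefficients of σ - 1 and the meaning of the jump. -/

section Galois

variable {OK k K : Type*} [CommRing OK] [IsDomain OK] [IsDiscreteValuationRing OK]
    [Field k] [Field K] [Algebra k K] [Algebra OK K] [IsFractionRing OK K] {ϖ : OK}

/-- First-order binomial expansion for integer exponents. Passing from j to j + 1 multiplies the
error by the unit 1 + ε and adds jε², so the induction runs in both directions. -/
lemma one_add_zpow_sub {ε : K} (hε : ValGE OK 1 ε) {h : ℤ} (hh : ValGE OK h ε) (j : ℤ) :
    ValGE OK (h + 1) ((1 + ε) ^ j - 1 - j * ε) := by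
  have h2 : ValGE OK (h + 1) (ε * ε) := hh.mul hε
  have hu : val OK (1 + ε) = 1 := by
    apply Valuation.map_one_add_of_lt
    exact lt_of_le_of_lt hε (by rw [← WithZero.exp_zero, WithZero.exp_lt_exp]; norm_num)
  have hu0 : 1 + ε ≠ 0 := by
    rintro h; simp [h] at hu
  have hmul : ∀ x : K, ValGE OK (h + 1) ((1 + ε) * x) ↔ ValGE OK (h + 1) x := fun x => by
    rw [ValGE, ValGE, map_mul, hu, one_mul]
  have hstep : ∀ j : ℤ, (1 + ε) ^ (j + 1) - 1 - (j + 1 : ℤ) * ε =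
      (1 + ε) * ((1 + ε) ^ j - 1 - j * ε) + j * (ε * ε) := fun j => by
    rw [zpow_add_one₀ hu0]; push_cast; ring
  have hint : ∀ j : ℤ, ValGE OK (h + 1) ((j : K) * (ε * ε)) := fun j => by
    simpa using (valGE_intCast j).mul h2
  induction j using Int.induction_on with
  | zero => simpa using ValGE.zero _
  | succ i ih =>
    rw [hstep]
    exact ((hmul _).2 ih).add (hint _)
  | pred i ih =>
    have := hstep (-i - 1)
    rw [sub_add_cancel] at this
    rw [← hmul, ← add_sub_cancel_right (_ * _), ← this]
    exact ih.sub (hint _)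

variable (k K) in
/-- The action of the Galois group on `K` by `k`-linear maps. -/
noncomputable abbrev galEnd : Gal(K/k) →* Module.End k K := DistribMulAction.toModuleEnd k K

lemma galEnd_apply (σ : Gal(K/k)) (x : K) : galEnd k K σ x = σ x := rfl

lemma hasLead_galEnd_sub_one (hG : GaloisIsometric OK k K) (hR : ResidueRep OK k K)
    (hϖ : Irreducible ϖ) {σ : Gal(K/k)} {h : ℤ} (h1 : 1 ≤ h)
    (hσ : ValGE OK h (σ (algebraMap OK K ϖ) / algebraMap OK K ϖ - 1)) :
    HasLead ϖ (galEnd k K σ - 1) h fun j =>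
      j * res OK ((σ (algebraMap OK K ϖ) / algebraMap OK K ϖ - 1) / algebraMap OK K ϖ ^ h) := by
  have h0 := map_uniformizer_ne_zero (K := K) hϖ
  set ε := σ (algebraMap OK K ϖ) / algebraMap OK K ϖ - 1 with hε
  have hσϖ : σ (algebraMap OK K ϖ) = algebraMap OK K ϖ * (1 + ε) := by rw [hε]; field_simp; ring
  have hpow : ∀ j : ℤ, (galEnd k K σ - 1) (algebraMap OK K ϖ ^ j) =
      algebraMap OK K ϖ ^ j * ((1 + ε) ^ j - 1 - j * ε) + algebraMap OK K ϖ ^ j * (j * ε) := by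
    intro j
    rw [LinearMap.sub_apply, galEnd_apply, map_zpow₀, hσϖ, mul_zpow, Module.End.one_apply]
    ring
  have hg : ∀ j : ℤ, ValGE OK (h + 1) ((1 + ε) ^ j - 1 - j * ε) := one_add_zpow_sub (hσ.mono h1) hσ
  have hl : ∀ j : ℤ, ValGE OK h (j * ε) := fun j => by simpa using (valGE_intCast j).mul hσ
  have hpowge : ∀ j : ℤ, ValGE OK (j + h) ((galEnd k K σ - 1) (algebraMap OK K ϖ ^ j)) := by
    intro j
    rw [hpow]
    exact (((valGE_uniformizer_zpow hϖ j).mul (hg j)).mono (by omega)).add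
      ((valGE_uniformizer_zpow hϖ j).mul (hl j))
  refine ⟨?_, fun j => ?_⟩
  -- The gain is improved one unit at a time up to h. The leading term aϖ^i already gains h, and the
  -- remainder starts one degree higher, so a gain of n on it counts as n + 1 relative to i.
  · have key : ∀ n : ℕ, (n : ℤ) ≤ h → ∀ (i : ℤ) (x : K), ValGE OK i x →
        ValGE OK (i + n) ((galEnd k K σ - 1) x) := by
      intro n
      induction n with
      | zero =>
        intro _ i x hx
        simpa using (hG σ i x hx).sub hx
      | succ n ih =>
        intro hn i x hx
        obtain ⟨a, ha, hxa⟩ := hR.exists_approx hϖ hx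
        have e : (galEnd k K σ - 1) x = algebraMap k K a * (galEnd k K σ - 1) (algebraMap OK K ϖ ^ i)
            + (galEnd k K σ - 1) (x - algebraMap k K a * algebraMap OK K ϖ ^ i) := by
          rw [map_sub _ x, ← Algebra.smul_def, ← Algebra.smul_def, map_smul]; abel
        rw [e]
        refine ValGE.add ((ha.mul (hpowge i)).mono (by omega)) ?_
        exact (ih (by push_cast at hn; omega) _ _ hxa).mono (by push_cast; omega)
    obtain ⟨n, rfl⟩ := Int.eq_ofNat_of_zero_le (zero_le_one.trans h1)
    exact key n le_rfl
  · have e : (galEnd k K σ - 1) (algebraMap OK K ϖ ^ j) / algebraMap OK K ϖ ^ (j + h) =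
        ((1 + ε) ^ j - 1 - j * ε) / algebraMap OK K ϖ ^ h + j * (ε / algebraMap OK K ϖ ^ h) := by
      have hj := zpow_ne_zero j h0
      have hh := zpow_ne_zero h h0
      rw [hpow, zpow_add₀ h0]
      field_simp
    have h3 : ValGE OK 1 (((1 + ε) ^ j - 1 - j * ε) / algebraMap OK K ϖ ^ h) := by
      simpa using (hg j).div_zpow hϖ (j := h)
    have h4 := valGE_zero_div hϖ hσ
    rw [e, res_add (h3.mono zero_le_one) (by simpa using (valGE_intCast j).mul h4),
      h3.res_eq_zero, zero_add, res_mul (valGE_intCast j) h4, res_intCast]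

/-- Every element of the Galois group of a totally ramified `p`-extension is wild. -/
lemma valGE_one_of_pow_eq_one (hG : GaloisIsometric OK k K) (hR : ResidueRep OK k K)
    (hϖ : Irreducible ϖ) (p : ℕ) [Fact p.Prime] [CharP (ResidueField OK) p] {m : ℕ} {σ : Gal(K/k)}
    (hσ : σ ^ p ^ m = 1) : ValGE OK 1 (σ (algebraMap OK K ϖ) / algebraMap OK K ϖ - 1) := by
  have h0 := map_uniformizer_ne_zero (K := K) hϖ
  have hϖ1 : ValGE OK 1 (algebraMap OK K ϖ) := by
    simpa using valGE_uniformizer_zpow (K := K) hϖ 1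
  obtain ⟨a, ha, h⟩ := hR.exists_approx hϖ (hG σ _ _ hϖ1)
  rw [zpow_one] at h
  have hapow : ∀ N : ℕ, ValGE OK 0 (algebraMap k K a ^ N) := by
    intro N
    induction N with
    | zero => simpa using valGE_algebraMap (K := K) (1 : OK)
    | succ N ih => simpa [pow_succ] using ih.mul ha
  -- σ multiplies ϖ by a modulo valuation 2. As σ fixes a, its N-th power multiplies ϖ by a^N.
  have key : ∀ N : ℕ, ValGE OK (1 + 1)
      ((σ ^ N) (algebraMap OK K ϖ) - algebraMap k K a ^ N * algebraMap OK K ϖ) := by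
    intro N
    induction N with
    | zero => simpa using ValGE.zero _
    | succ N ih =>
      have e : (σ ^ (N + 1)) (algebraMap OK K ϖ) - algebraMap k K a ^ (N + 1) * algebraMap OK K ϖ =
          σ ((σ ^ N) (algebraMap OK K ϖ) - algebraMap k K a ^ N * algebraMap OK K ϖ) +
          algebraMap k K a ^ N * (σ (algebraMap OK K ϖ) - algebraMap k K a * algebraMap OK K ϖ) := by
        rw [map_sub, map_mul, map_pow, AlgEquiv.commutes, pow_succ' σ, AlgEquiv.mul_apply]
        ring
      rw [e]
      exact (hG _ _ _ ih).add (by simpa using (hapow N).mul h)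
  have h1 := key (p ^ m)
  rw [hσ, AlgEquiv.one_apply, ← one_sub_mul] at h1
  have h2 := h1.div_zpow hϖ (j := 1)
  rw [zpow_one, mul_div_cancel_right₀ _ h0, add_sub_cancel_right] at h2
  have hra : res OK (algebraMap k K a) = 1 := by
    have h3 := h2.res_eq_zero
    have hrp : ∀ N : ℕ, res OK (algebraMap k K a ^ N) = res OK (algebraMap k K a) ^ N := by
      intro N
      induction N with
      | zero => simp [res_one]
      | succ N ih => rw [pow_succ, pow_succ, res_mul (hapow N) ha, ih]
    rw [res_sub (by simpa using valGE_algebraMap (K := K) (1 : OK)) (hapow _), res_one, hrp] at h3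
    -- The residue of a is a p^m-th root of unity in characteristic p, hence equal to 1.
    have h4 : (res OK (algebraMap k K a) - 1) ^ p ^ m = 0 := by
      rw [sub_pow_char_pow, one_pow, ← neg_sub, h3, neg_zero]
    exact sub_eq_zero.1 (pow_eq_zero_iff (pow_ne_zero _ (Fact.out : p.Prime).ne_zero) |>.1 h4)
  have h5 : ValGE OK 1 (algebraMap k K a - 1) := by
    have h1' : ValGE OK 0 (1 : K) := by simpa using valGE_algebraMap (K := K) (1 : OK)
    rw [← res_eq_zero_iff (ha.sub h1'), res_sub ha h1', hra, res_one, sub_self]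
  have e : σ (algebraMap OK K ϖ) / algebraMap OK K ϖ - 1 = (σ (algebraMap OK K ϖ) -
      algebraMap k K a * algebraMap OK K ϖ) / algebraMap OK K ϖ ^ (1 : ℤ) +
      (algebraMap k K a - 1) := by
    rw [zpow_one]; field_simp; ring
  rw [e]
  exact (by simpa using h.div_zpow hϖ (j := 1) : ValGE OK 1 _).add h5

/-- If ε = 0, then σ - 1 raises valuations by arbitrarily large amounts and so vanishes. -/
lemma galois_eq_one_of_map_uniformizer (hG : GaloisIsometric OK k K) (hR : ResidueRep OK k K)
    (hϖ : Irreducible ϖ) {σ : Gal(K/k)} (h : σ (algebraMap OK K ϖ) = algebraMap OK K ϖ) :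
    σ = 1 := by
  have h0 := map_uniformizer_ne_zero (K := K) hϖ
  ext x
  obtain ⟨i, hi⟩ := exists_valGE (OK := OK) x
  rw [AlgEquiv.one_apply, ← sub_eq_zero]
  refine valGE_of_forall (OK := OK) fun n => ?_
  have := (hasLead_galEnd_sub_one hG hR hϖ (σ := σ) (h := max 1 (n - i)) (le_max_left _ _)
    (by rw [h, div_self h0, sub_self]; exact ValGE.zero _)).valGE i x hi
  exact this.mono (by omega)

/-- The jump of `σ ≠ 1` is the valuation of `σ(ϖ) / ϖ - 1`. -/
lemma jump_spec (hG : GaloisIsometric OK k K) (hR : ResidueRep OK k K)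
    (hϖ : Irreducible ϖ) {σ : Gal(K/k)} (hσ : σ ≠ 1)
    (hw : ValGE OK 1 (σ (algebraMap OK K ϖ) / algebraMap OK K ϖ - 1)) :
    1 ≤ jump OK σ ∧ ValGE OK (jump OK σ) (σ (algebraMap OK K ϖ) / algebraMap OK K ϖ - 1) ∧
      ¬ ValGE OK (jump OK σ + 1) (σ (algebraMap OK K ϖ) / algebraMap OK K ϖ - 1) := by
  have h0 := map_uniformizer_ne_zero (K := K) hϖ
  have hne : σ (algebraMap OK K ϖ) / algebraMap OK K ϖ - 1 ≠ 0 := by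
    intro h
    rw [sub_eq_zero, div_eq_one_iff_eq h0] at h
    exact hσ (galois_eq_one_of_map_uniformizer hG hR hϖ h)
  obtain ⟨v, hv, hv'⟩ := exists_valGE_not_succ (OK := OK) hne
  have hv1 : 1 ≤ v := by
    by_contra hlt
    exact hv' (hw.mono (by omega))
  obtain ⟨h, rfl⟩ := Int.eq_ofNat_of_zero_le (zero_le_one.trans hv1)
  -- Testing on ϖ bounds i by v(ε). Conversely, subtracting from x a representative of its residue
  -- in k does not change (σ - 1)x, and the difference has valuation at least 1, which supplies the
  -- extra 1 in the definition of `ramGroup`.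
  have hset : {i : ℕ | σ ∈ ramGroup OK i} = Set.Iic h := by
    ext i
    refine ⟨fun hi => ?_, fun hi x => ?_⟩
    · have h1 := ((hi ϖ).div_zpow hϖ (j := 1))
      rw [zpow_one, sub_div, div_self h0, add_sub_cancel_right] at h1
      by_contra hlt
      exact hv' (h1.mono (by simp at hlt; omega))
    · obtain ⟨a, ha, hxa⟩ := hR x
      have h2 := (hasLead_galEnd_sub_one hG hR hϖ hv1 hv).valGE _ _ hxa
      rw [LinearMap.sub_apply, galEnd_apply, map_sub, AlgEquiv.commutes, Module.End.one_apply,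
        sub_sub_sub_cancel_right] at h2
      exact h2.mono (by simp at hi; omega)
  have hj : jump OK σ = h := by
    rw [jump, hset, csSup_Iic]
  rw [hj]
  exact ⟨by omega, hv, hv'⟩

end Galois

/-! ### Congruence of the jumps and products of the σ_i - 1. -/

section Jumps

variable {OK k K : Type*} [CommRing OK] [IsDomain OK] [IsDiscreteValuationRing OK]
    [Field k] [Field K] [Algebra k K] [Algebra OK K] [IsFractionRing OK K] {ϖ : OK}

variable (k K) in
/-- Every element of the Galois group is wild: `σ(ϖ) / ϖ` is a principal unit. -/
def Wild (ϖ : OK) : Prop :=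
  ∀ σ : Gal(K/k), ValGE OK 1 (σ (algebraMap OK K ϖ) / algebraMap OK K ϖ - 1)

lemma exists_hasLead_jump (hG : GaloisIsometric OK k K) (hR : ResidueRep OK k K)
    (hϖ : Irreducible ϖ) (hw : Wild k K ϖ) {σ : Gal(K/k)} (hσ : σ ≠ 1) :
    ∃ c : ResidueField OK, c ≠ 0 ∧
      HasLead ϖ (galEnd k K σ - 1) (jump OK σ) fun j => j * c := by
  obtain ⟨h1, h2, h3⟩ := jump_spec hG hR hϖ hσ (hw σ)
  refine ⟨_, ?_, hasLead_galEnd_sub_one hG hR hϖ (by exact_mod_cast h1) h2⟩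
  rwa [Ne, res_div_eq_zero_iff hϖ h2]

/-- Every jump is congruent to the largest one. -/
lemma jump_cast_eq_of_forall_le (hG : GaloisIsometric OK k K) (hR : ResidueRep OK k K)
    (hϖ : Irreducible ϖ) (hw : Wild k K ϖ) {s t : Gal(K/k)} (hs : s ≠ 1) (ht : t ≠ 1)
    (hmax : ∀ τ : Gal(K/k), τ ≠ 1 → jump OK τ ≤ jump OK t) :
    (jump OK s : ResidueField OK) = jump OK t := by
  have h0 := map_uniformizer_ne_zero (K := K) hϖ
  obtain ⟨cs, hcs, hls⟩ := exists_hasLead_jump hG hR hϖ hw hs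
  obtain ⟨ct, hct, hlt⟩ := exists_hasLead_jump hG hR hϖ hw ht
  have h1 := hls.mul hR hϖ hlt
  have h2 := hlt.mul hR hϖ hls
  rw [add_comm] at h2
  -- The quadratic terms in j cancel, leaving the coefficient j cs ct (h(t) - h(s)).
  have h3 := h1.sub hϖ h2
  have hcomm : (galEnd k K s - 1) * (galEnd k K t - 1) - (galEnd k K t - 1) * (galEnd k K s - 1) =
      galEnd k K (s * t) - galEnd k K (t * s) := by
    rw [map_mul, map_mul]; simp only [sub_mul, mul_sub, one_mul, mul_one]; abel
  rw [hcomm] at h3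
  by_cases hst : s * t = t * s
  · have h4 := h3.res_eq 1
    rw [hst, sub_self, LinearMap.zero_apply, zero_div, res_zero] at h4
    have h5 : cs * ct * ((jump OK s : ResidueField OK) - jump OK t) = 0 := by
      push_cast at h4
      linear_combination h4
    simpa [hcs, hct, sub_eq_zero] using h5
  -- A nontrivial commutator w would satisfy h(w) ≥ h(s) + h(t) > h(t), against the maximality of
  -- h(t).
  · exfalso
    set w := s * t * (t * s)⁻¹ with hwdef
    have hw1 : w ≠ 1 := fun h => hst (by rwa [hwdef, mul_inv_eq_one] at h)
    obtain ⟨h5, h6, h7⟩ := jump_spec hG hR hϖ hw1 (hw w)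
    obtain ⟨h8, -, -⟩ := jump_spec hG hR hϖ hs (hw s)
    have hϖ1 : ValGE OK 1 (algebraMap OK K ϖ) := by
      simpa using valGE_uniformizer_zpow (K := K) hϖ 1
    have h9 := h3.valGE _ _ (hG (t * s)⁻¹ _ _ hϖ1)
    have e : (galEnd k K (s * t) - galEnd k K (t * s)) ((t * s)⁻¹ (algebraMap OK K ϖ)) =
        w (algebraMap OK K ϖ) - algebraMap OK K ϖ := by
      rw [LinearMap.sub_apply, galEnd_apply, galEnd_apply, ← AlgEquiv.mul_apply,
        ← AlgEquiv.mul_apply, mul_inv_cancel, AlgEquiv.one_apply]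
    rw [e] at h9
    have h10 := h9.div_zpow hϖ (j := 1)
    rw [zpow_one, sub_div, div_self h0] at h10
    have := hmax w hw1
    exact h7 (h10.mono (by omega))

lemma jump_modEq_jumpResidue [FiniteDimensional k K] (hG : GaloisIsometric OK k K)
    (hR : ResidueRep OK k K) (hϖ : Irreducible ϖ) (hw : Wild k K ϖ) (p : ℕ)
    [CharP (ResidueField OK) p] {τ : Gal(K/k)} (hτ : τ ≠ 1) :
    jump OK τ ≡ jumpResidue OK k K p [MOD p] := by
  have : Nonempty {σ : Gal(K/k) // σ ≠ 1} := ⟨⟨τ, hτ⟩⟩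
  obtain ⟨⟨t, ht⟩, hmax⟩ := Finite.exists_max fun σ : {σ : Gal(K/k) // σ ≠ 1} => jump OK σ.1
  have hall : ∀ s : Gal(K/k), s ≠ 1 → (jump OK s : ResidueField OK) = jump OK t := fun s hs =>
    jump_cast_eq_of_forall_le hG hR hϖ hw hs ht fun τ hτ => hmax ⟨τ, hτ⟩
  have hmem := Nat.sInf_mem (s := {h : ℕ | ∃ σ : Gal(K/k), σ ≠ 1 ∧ jump OK σ = h}) ⟨_, τ, hτ, rfl⟩
  obtain ⟨s, hs, hsj⟩ := hmem
  rw [jumpResidue, ← hsj, Nat.ModEq, Nat.mod_mod]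
  exact (CharP.natCast_eq_natCast (ResidueField OK) p).1 ((hall τ hτ).trans (hall s hs).symm)

lemma jump_cast_eq_jumpResidue [FiniteDimensional k K] (hG : GaloisIsometric OK k K)
    (hR : ResidueRep OK k K) (hϖ : Irreducible ϖ) (hw : Wild k K ϖ) (p : ℕ)
    [CharP (ResidueField OK) p] {τ : Gal(K/k)} (hτ : τ ≠ 1) :
    (jump OK τ : ResidueField OK) = jumpResidue OK k K p :=
  CharP.natCast_eq_natCast (ResidueField OK) p |>.2 (jump_modEq_jumpResidue hG hR hϖ hw p hτ)

/-- The leading coefficients of the operator `(σ_1 - 1) ⋯ (σ_a - 1)`. -/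
lemma exists_hasLead_list_prod (hG : GaloisIsometric OK k K) (hR : ResidueRep OK k K)
    (hϖ : Irreducible ϖ) (hw : Wild k K ϖ) {hbar : ResidueField OK}
    (hjump : ∀ τ : Gal(K/k), τ ≠ 1 → (jump OK τ : ResidueField OK) = hbar)
    (L : List Gal(K/k)) (hL : ∀ σ ∈ L, σ ≠ 1) :
    ∃ c : ResidueField OK, c ≠ 0 ∧
      HasLead ϖ (L.map fun σ => galEnd k K σ - 1).prod (L.map fun σ => (jump OK σ : ℤ)).sum
        fun j => c * ∏ l ∈ Finset.Icc 1 L.length,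
          (((j + (L.map fun σ => (jump OK σ : ℤ)).sum : ℤ) : ResidueField OK) - l * hbar) := by
  induction L with
  | nil => exact ⟨1, one_ne_zero, by simpa using HasLead.one hϖ⟩
  | cons σ L ih =>
    obtain ⟨c, hc, hl⟩ := ih fun τ hτ => hL τ (List.mem_cons_of_mem _ hτ)
    have hσ : σ ≠ 1 := hL σ List.mem_cons_self
    obtain ⟨d, hd, hs⟩ := exists_hasLead_jump hG hR hϖ hw hσ
    have h := hs.mul hR hϖ hl
    refine ⟨c * d, mul_ne_zero hc hd, ?_⟩
    rw [List.map_cons, List.prod_cons, List.map_cons, List.sum_cons, add_comm (jump OK σ : ℤ)]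
    convert h using 1
    ext j
    have e : ∀ f : ℕ → ResidueField OK, ∏ l ∈ Finset.Icc 1 (L.length + 1), f l =
        f 1 * ∏ l ∈ Finset.Icc 1 L.length, f (l + 1) := fun f => by
      rw [← Finset.prod_Ioc_mul_eq_prod_Icc (by omega), mul_comm]
      congr 1
      rw [show Finset.Ioc 1 (L.length + 1) = (Finset.Icc 1 L.length).map (addRightEmbedding 1) by
        ext x; simp; omega, Finset.prod_map]
      rfl
    rw [List.length_cons, e]
    -- Prepending σ adds h(σ), which is `hbar` in F, to the total shift and thereby moves every
    -- index l to l + 1. The case l = 0 is the new factor contributed by σ - 1.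
    have e2 : ∀ l : ℕ, ((j + ((L.map fun σ => (jump OK σ : ℤ)).sum + jump OK σ) : ℤ) :
        ResidueField OK) - ((l + 1 : ℕ) : ResidueField OK) * hbar =
        ((j + (L.map fun σ => (jump OK σ : ℤ)).sum : ℤ) : ResidueField OK) - l * hbar := by
      intro l
      push_cast
      rw [hjump σ hσ]; ring
    have e3 := e2 0
    simp only [zero_add, Nat.cast_zero, zero_mul, sub_zero] at e3
    rw [e3, Finset.prod_congr rfl fun l _ => e2 l]
    ring

end Jumps

/-! ### From operators on K back to the group algebra. -/

section GroupAlgebra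

variable {OK k K : Type*} [CommRing OK] [IsDomain OK] [IsDiscreteValuationRing OK]
    [Field k] [Field K] [Algebra k K] [Algebra OK K] [IsFractionRing OK K] {ϖ : OK}

variable (k K) in
/-- The action of `k[G]` on `K`. -/
noncomputable abbrev groupAlgebraEnd : MonoidAlgebra k Gal(K/k) →ₐ[k] Module.End k K :=
  MonoidAlgebra.lift k (Module.End k K) Gal(K/k) (galEnd k K)

lemma act_add (f g : MonoidAlgebra K Gal(K/k)) (x : K) : act (f + g) x = act f x + act g x := by
  simp only [act]
  exact Finsupp.sum_add_index' (by simp) (by simp [add_mul])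

lemma act_incl (f : MonoidAlgebra k Gal(K/k)) (x : K) :
    act (incl k K f) x = groupAlgebraEnd k K f x := by
  induction f using MonoidAlgebra.induction_linear with
  | zero => simp [act]
  | add f g hf hg => rw [map_add, act_add, hf, hg, map_add, LinearMap.add_apply]
  | single σ a =>
    rw [MonoidAlgebra.lift_single, LinearMap.smul_apply, galEnd_apply, Algebra.smul_def]
    simp [act, incl]

/-- The product `(σ_1 - 1) ⋯ (σ_a - 1)` in `k[G]` for a list of `σ_i`. -/
noncomputable def listProd (L : List Gal(K/k)) : MonoidAlgebra k Gal(K/k) :=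
  (L.map fun σ => MonoidAlgebra.of k Gal(K/k) σ - 1).prod

lemma groupAlgebraEnd_listProd (L : List Gal(K/k)) :
    groupAlgebraEnd k K (listProd L) = (L.map fun σ => galEnd k K σ - 1).prod := by
  rw [listProd, map_list_prod, List.map_map]
  congr 2
  ext1 σ
  simp

lemma prodSub_eq_listProd {a : ℕ} (σ : Fin a → Gal(K/k)) :
    prodSub σ = listProd (List.ofFn σ) := by
  rw [prodSub, listProd, List.map_ofFn]; rfl

lemma listProd_replicate (σ : Gal(K/k)) (m : ℕ) :
    listProd (List.replicate m σ) = (MonoidAlgebra.of k Gal(K/k) σ - 1) ^ m := by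
  rw [listProd, List.map_replicate, List.prod_replicate]

lemma listProd_append (L L' : List Gal(K/k)) :
    listProd (L ++ L') = listProd L * listProd L' := by
  rw [listProd, List.map_append, List.prod_append]; rfl

lemma listProd_flatten (L : List (List Gal(K/k))) :
    listProd L.flatten = (L.map listProd).prod := by
  induction L with
  | nil => rfl
  | cons l L ih => rw [List.flatten_cons, listProd_append, ih, List.map_cons, List.prod_cons]

/-- Writing powers as repeated entries lets the results on lists cover the elements of B as well. -/
lemma prodPow_eq_listProd {a : ℕ} (σ : Fin a → Gal(K/k)) (m : Fin a → ℕ) :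
    prodPow σ m = listProd (List.ofFn fun i => List.replicate (m i) (σ i)).flatten := by
  rw [prodPow, listProd_flatten, List.map_ofFn]
  congr 2
  ext1 i
  exact (listProd_replicate _ _).symm

lemma mem_modC_iff {i : ℤ} {f : MonoidAlgebra K Gal(K/k)} :
    f ∈ modC OK k K i ↔ ∀ (j : ℤ) (x : K), ValGE OK j x → ValGE OK (j + i) (act f x) := by
  refine ⟨fun h j x hx => ?_, fun h x => ?_⟩
  · refine (h x).trans ?_
    rw [neg_add, add_comm, WithZero.exp_add]
    exact mul_le_mul_right hx _
  · by_cases hx : x = 0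
    · subst hx
      have : act f 0 = 0 := by simp [act]
      simp [this]
    · have hv : val OK x ≠ 0 := (Valuation.ne_zero_iff _).2 hx
      have h1 := h (-WithZero.log (val OK x)) x (by simp [ValGE, WithZero.exp_log hv])
      rw [ValGE, neg_add, neg_neg, WithZero.exp_add, WithZero.exp_log hv, mul_comm] at h1
      exact h1

lemma HasLead.mem_modA {f : MonoidAlgebra k Gal(K/k)} {h : ℤ} {φ : ℤ → ResidueField OK}
    (hf : HasLead ϖ (groupAlgebraEnd k K f) h φ) : f ∈ modA OK k K h := by
  rw [modA, Set.mem_ofPred_eq, mem_modC_iff]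
  intro j x hx
  rw [act_incl]
  exact hf.valGE j x hx

/-- One nonzero coefficient shows that the shift h is sharp, so the set of admissible shifts is
bounded and `sSup` is its true maximum. -/
lemma HasLead.level_eq (hϖ : Irreducible ϖ) {f : MonoidAlgebra k Gal(K/k)} {h : ℤ}
    {φ : ℤ → ResidueField OK} (hf : HasLead ϖ (groupAlgebraEnd k K f) h φ) {j : ℤ} (hj : φ j ≠ 0) :
    level (OK := OK) (incl k K f) = h := by
  have hset : {i : ℤ | incl k K f ∈ modC OK k K i} = Set.Iic h := by
    ext i
    rw [Set.mem_ofPred_eq, Set.mem_Iic, mem_modC_iff]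
    simp only [act_incl]
    refine ⟨fun hi => ?_, fun hi j x hx => (hf.valGE j x hx).mono (by omega)⟩
    by_contra hlt
    have hjϖ := valGE_uniformizer_zpow (K := K) hϖ j
    rw [← hf.res_eq, Ne, res_div_eq_zero_iff hϖ (hf.valGE _ _ hjϖ)] at hj
    exact hj ((hi _ _ hjϖ).mono (by omega))
  rw [level, hset, csSup_Iic]

end GroupAlgebra

/-! ### The different and the trace constant. -/

section Different

open scoped nonZeroDivisors

variable {O OK k K : Type*}
    [CommRing O] [IsDomain O] [IsDiscreteValuationRing O]
    [CommRing OK] [IsDomain OK] [IsDiscreteValuationRing OK]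
    [Field k] [Field K] [Algebra O k] [IsFractionRing O k] [Algebra OK K] [IsFractionRing OK K]
    [Algebra k K] [FiniteDimensional k K] [IsGalois k K]
    [Algebra O OK] [Algebra O K] [IsScalarTower O OK K] [IsScalarTower O k K]
    [IsIntegralClosure OK O K] [Module.IsTorsionFree O OK]

variable (O) in
/-- The inverse different, described by valuations. -/
lemma forall_trace_mem_iff (x : K) :
    (∀ y : OK, Algebra.trace k K (x * algebraMap OK K y) ∈ (algebraMap O k).range) ↔
      ValGE OK (-(multiplicity (maximalIdeal OK) (differentIdeal O OK) : ℤ)) x := by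
  obtain ⟨ϖ, hϖ⟩ := IsDiscreteValuationRing.exists_irreducible OK
  have hD := coeIdeal_differentIdeal O k K OK
  have hD0 : differentIdeal O OK ≠ ⊥ := by
    rw [← FractionalIdeal.coeIdeal_ne_zero (K := K), hD]
    simp
  obtain ⟨e, he⟩ := IsDiscreteValuationRing.ideal_eq_span_pow_irreducible hD0 hϖ
  have hM : maximalIdeal OK = Ideal.span {ϖ} :=
    (IsDiscreteValuationRing.irreducible_iff_uniformizer _).1 hϖ
  -- The different is nonzero, so `multiplicity` is the genuine exponent and not its default value.
  have hmult : multiplicity (maximalIdeal OK) (differentIdeal O OK) = e := by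
    rw [he, ← Ideal.span_singleton_pow, ← hM]
    exact multiplicity_pow_self (IsDiscreteValuationRing.not_a_field OK)
      (fun h => (maximalIdeal.isMaximal OK).ne_top (Ideal.isUnit_iff.1 h)) _
  have hdual : FractionalIdeal.dual O k (1 : FractionalIdeal OK⁰ K) =
      ((differentIdeal O OK : FractionalIdeal OK⁰ K))⁻¹ := by rw [hD, inv_inv]
  have h1 : x ∈ FractionalIdeal.dual O k (1 : FractionalIdeal OK⁰ K) ↔
      ∀ y : OK, Algebra.trace k K (x * algebraMap OK K y) ∈ (algebraMap O k).range := by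
    rw [FractionalIdeal.mem_dual (one_ne_zero (α := FractionalIdeal OK⁰ K))]
    refine ⟨fun h y => h _ (FractionalIdeal.coe_mem_one _ _), fun h a ha => ?_⟩
    obtain ⟨y, rfl⟩ := (FractionalIdeal.mem_one_iff _).1 ha
    exact h y
  rw [← h1, hdual, FractionalIdeal.mem_inv_iff (by simpa using hD0), hmult, valGE_iff hϖ]
  have h0 := map_uniformizer_ne_zero (K := K) hϖ
  constructor
  · intro h
    obtain ⟨y, hy⟩ := (FractionalIdeal.mem_one_iff _).1 (h (algebraMap OK K (ϖ ^ e))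
      (FractionalIdeal.mem_coeIdeal_of_mem _ (he ▸ Ideal.mem_span_singleton_self _)))
    refine ⟨y, ?_⟩
    rw [hy, map_pow, zpow_neg, zpow_natCast]
    field_simp
  · rintro ⟨y, rfl⟩ z hz
    obtain ⟨w, hw, rfl⟩ := (FractionalIdeal.mem_coeIdeal _).1 hz
    rw [he, Ideal.mem_span_singleton] at hw
    obtain ⟨c, rfl⟩ := hw
    refine (FractionalIdeal.mem_one_iff _).2 ⟨y * c, ?_⟩
    rw [map_mul, map_mul, map_pow, zpow_neg, zpow_natCast]
    field_simp

variable (O k) in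
-- The element z = ϖ^(-d) has valuation n - 1 - e, where e is the exponent of the different, so its
-- trace is integral. Were the trace divisible by a uniformizer t of O, then x = z/t, of valuation
-- -e - 1, would lie in the inverse different, which is impossible. Without this the normalizing
-- factor of `pmap` would be the inverse of 0.
lemma res_trace_ne_zero (hram : TotallyRamified O OK k K) {ϖ : OK} (hϖ : Irreducible ϖ) :
    res OK (algebraMap k K (Algebra.trace k K
      (algebraMap OK K ϖ ^ (-(ramDepth O OK k K))))) ≠ 0 := by
  have h0 := map_uniformizer_ne_zero (K := K) hϖ
  obtain ⟨t, ht⟩ := IsDiscreteValuationRing.exists_irreducible O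
  have hMO : maximalIdeal O = Ideal.span {t} :=
    (IsDiscreteValuationRing.irreducible_iff_uniformizer _).1 ht
  have hM : maximalIdeal OK = Ideal.span {ϖ} :=
    (IsDiscreteValuationRing.irreducible_iff_uniformizer _).1 hϖ
  set n := Module.finrank k K with hn
  have hn1 : 0 < n := Module.finrank_pos
  have htK : ∀ a : O, algebraMap k K (algebraMap O k a) = algebraMap OK K (algebraMap O OK a) :=
    fun a => by rw [← IsScalarTower.algebraMap_apply O k K, IsScalarTower.algebraMap_apply O OK K]
  have ht0 : algebraMap O k t ≠ 0 := by simpa using ht.ne_zero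
  have hdvd : ϖ ^ n ∣ algebraMap O OK t := by
    have h := hram
    rw [TotallyRamified, hMO, Ideal.map_span, Set.image_singleton, hM,
      Ideal.span_singleton_pow] at h
    rw [← Ideal.mem_span_singleton, ← h]
    exact Ideal.mem_span_singleton_self _
  have htv : ValGE OK n (algebraMap k K (algebraMap O k t)) := by
    obtain ⟨c, hc⟩ := hdvd
    exact (valGE_iff hϖ).2 ⟨c, by rw [htK, hc, map_mul, map_pow, zpow_natCast]⟩
  set e : ℤ := ((multiplicity (maximalIdeal OK) (differentIdeal O OK) : ℕ) : ℤ) with he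
  have hd : -(ramDepth O OK k K) = n - 1 - e := by rw [ramDepth]; ring
  rw [hd]
  set z := algebraMap OK K ϖ ^ ((n : ℤ) - 1 - e) with hz
  have hzv : ValGE OK (n - 1 - e) z := valGE_uniformizer_zpow hϖ _
  obtain ⟨b, hb⟩ := (forall_trace_mem_iff O (k := k) z).2 (hzv.mono (by omega)) 1
  rw [map_one, mul_one] at hb
  rw [← hb, htK, res_algebraMap, Ne, residue_eq_zero_iff]
  intro hbM
  have hbO : b ∈ maximalIdeal O := by
    rw [mem_maximalIdeal, mem_nonunits_iff] at hbM ⊢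
    exact fun h => hbM (h.map _)
  rw [hMO, Ideal.mem_span_singleton] at hbO
  obtain ⟨b', rfl⟩ := hbO
  set x := (algebraMap O k t)⁻¹ • z with hx
  have hxz : z = algebraMap k K (algebraMap O k t) * x := by
    rw [hx, Algebra.smul_def, map_inv₀, mul_inv_cancel_left₀ (by simpa using ht0)]
  have htx : Algebra.trace k K x = algebraMap O k b' := by
    rw [hx, map_smul, ← hb, map_mul, smul_eq_mul, inv_mul_cancel_left₀ ht0]
  have hxtv : ValGE OK (-e - 1) x := by
    obtain ⟨c, hc⟩ : ∃ c : OK, algebraMap O OK t * c = ϖ ^ n := by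
      have h := hram
      rw [TotallyRamified, hMO, Ideal.map_span, Set.image_singleton, hM,
        Ideal.span_singleton_pow] at h
      have : ϖ ^ n ∈ Ideal.span {algebraMap O OK t} := h ▸ Ideal.mem_span_singleton_self _
      exact (Ideal.mem_span_singleton.1 this).imp fun _ h => h.symm
    have hc0 : algebraMap OK K (algebraMap O OK t) ≠ 0 := by
      rw [← htK]; simpa using ht0
    refine (valGE_iff hϖ).2 ⟨c, mul_left_cancel₀ hc0 ?_⟩
    rw [← htK, ← hxz, htK, mul_left_comm, ← map_mul, hc, map_pow, hz, ← zpow_natCast,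
      ← zpow_add₀ h0]
    congr 1; ring
  -- Split y as an element a of O plus an element of the maximal ideal. The first part contributes a
  -- times the integral trace of x, and the second brings the valuation up to -e.
  have hall : ∀ y : OK, Algebra.trace k K (x * algebraMap OK K y) ∈ (algebraMap O k).range := by
    intro y
    obtain ⟨a, ha⟩ := exists_residue_eq O OK k K hram y
    have hy' : ValGE OK 1 (algebraMap OK K (y - algebraMap O OK a)) := by
      rw [← res_eq_zero_iff (valGE_algebraMap _), res_algebraMap, residue_eq_zero_iff]
      exact ha
    have h1 := (forall_trace_mem_iff O (k := k) (x * algebraMap OK K (y - algebraMap O OK a))).2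
      ((hxtv.mul hy').mono (by omega)) 1
    rw [map_one, mul_one] at h1
    have h2 : x * algebraMap OK K y = algebraMap O k a • x +
        x * algebraMap OK K (y - algebraMap O OK a) := by
      rw [Algebra.smul_def, htK, map_sub]; ring
    rw [h2, map_add, map_smul, htx, smul_eq_mul, ← map_mul]
    exact add_mem ⟨_, rfl⟩ h1
  have h3 := htv.mul ((forall_trace_mem_iff O x).1 hall)
  rw [← hxz, ValGE, hz, val_uniformizer_zpow hϖ, WithZero.exp_le_exp] at h3
  omega

end Different

/-! ### The map p_i in terms of leading coefficients. -/

section LeadingTerm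

variable {O OK k K : Type*} [CommRing O] [IsDomain O] [IsDiscreteValuationRing O]
    [CommRing OK] [IsDomain OK] [IsDiscreteValuationRing OK] [Algebra O OK]
    [Module.IsTorsionFree O OK]
    [Field k] [Field K] [Algebra k K] [Algebra OK K] [IsFractionRing OK K] {ϖ : OK}

lemma HasLead.pmap_eq {f : MonoidAlgebra k Gal(K/k)} {h : ℤ} {φ : ℤ → ResidueField OK}
    (hf : HasLead ϖ (groupAlgebraEnd k K f) h φ) :
    pmap O ϖ h (incl k K f) =
      (res OK (algebraMap k K (Algebra.trace k K
        ((algebraMap OK K ϖ) ^ (-(ramDepth O OK k K))))))⁻¹ •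
      ∑ j ∈ Finset.range (Module.finrank k K), φ (j - h) • XX OK k K ^ j := by
  rw [pmap]
  congr 1
  refine Finset.sum_congr rfl fun j _ => ?_
  rw [act_incl, ← hf.res_eq, sub_add_cancel, zpow_natCast]

end LeadingTerm

/-! ### Order of vanishing at 1 in characteristic p. -/

section Polynomials

variable {F : Type*} [Field F] (p : ℕ) [Fact p.Prime] [CharP F p]

lemma geom_sum_eq_X_sub_one_pow (m : ℕ) :
    ∑ j ∈ Finset.range (p ^ m), (X : F[X]) ^ j = (X - 1) ^ (p ^ m - 1) := by
  have h0 : (X - 1 : F[X]) ≠ 0 := by simpa using X_sub_C_ne_zero (1 : F)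
  refine mul_right_cancel₀ h0 ?_
  rw [geom_sum_mul, ← pow_succ, Nat.sub_add_cancel (Nat.one_le_pow _ _ (Fact.out : p.Prime).pos),
    sub_pow_char_pow, one_pow]

/-- `∑_{j < n} ∏_{l ≤ a} (j - c_l) X^j`. -/
noncomputable def coeffPoly (c : ℕ → F) (n a : ℕ) : F[X] :=
  ∑ j ∈ Finset.range n, C (∏ l ∈ Finset.Icc 1 a, ((j : F) - c l)) * X ^ j

/-- The Euler operator X d/dX multiplies X^j by j, so each new factor j - c is an application of X
d/dX - c. -/
lemma coeffPoly_succ (c : ℕ → F) (n a : ℕ) :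
    coeffPoly c n (a + 1) = X * derivative (coeffPoly c n a) - C (c (a + 1)) * coeffPoly c n a := by
  rw [coeffPoly, coeffPoly, derivative_sum, Finset.mul_sum, Finset.mul_sum,
    ← Finset.sum_sub_distrib]
  refine Finset.sum_congr rfl fun j _ => ?_
  rw [Finset.prod_Icc_succ_top (by omega), derivative_C_mul, derivative_X_pow, C_mul, C_sub]
  cases j with
  | zero => simp; ring
  | succ j => rw [Nat.add_sub_cancel, pow_succ]; ring

lemma cast_pow_sub_one_sub {m a : ℕ} (ha : a + 1 < p ^ m) :
    ((p ^ m - 1 - a : ℕ) : F) = -((a + 1 : ℕ) : F) := by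
  have hm : m ≠ 0 := by rintro rfl; simp at ha
  have h : ((p ^ m - 1 - a + (a + 1) : ℕ) : F) = 0 := by
    rw [show p ^ m - 1 - a + (a + 1) = p ^ m by omega, Nat.cast_pow, CharP.cast_eq_zero F p,
      zero_pow hm]
  rw [Nat.cast_add] at h
  exact eq_neg_of_add_eq_zero_left h

/-- The exact order of vanishing of `coeffPoly` at `1`. -/
lemma exists_coeffPoly_eq (c : ℕ → F) {m a : ℕ} (hap : a < p) (han : a < p ^ m) :
    ∃ Q : F[X], coeffPoly c (p ^ m) a = (X - 1) ^ (p ^ m - 1 - a) * Q ∧ Q.eval 1 ≠ 0 := by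
  induction a with
  | zero => exact ⟨1, by simp [coeffPoly, geom_sum_eq_X_sub_one_pow], by simp⟩
  | succ a ih =>
    obtain ⟨Q, hQ, hQ1⟩ := ih (by omega) (by omega)
    obtain ⟨N, hN⟩ : ∃ N, p ^ m - 1 - a = N + 1 := ⟨p ^ m - 1 - (a + 1), by omega⟩
    have hcast := cast_pow_sub_one_sub (F := F) p han
    rw [hN] at hQ hcast
    -- This is the cofactor left by applying X d/dX - c to (X - 1)^(N+1) Q. Its value at 1 is (N +
    -- 1) Q(1), where N + 1 equals -(a + 1) in F and is nonzero because a + 1 < p.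
    refine ⟨C ((N + 1 : ℕ) : F) * X * Q + (X - 1) * (X * derivative Q - C (c (a + 1)) * Q), ?_, ?_⟩
    · rw [coeffPoly_succ, hQ, show p ^ m - 1 - (a + 1) = N by omega, derivative_mul,
        derivative_pow, Nat.add_sub_cancel, derivative_sub, derivative_X, derivative_one, pow_succ]
      ring
    · have h : ((a + 1 : ℕ) : F) ≠ 0 := by
        rw [Ne, CharP.cast_eq_zero_iff F p]
        exact fun h => absurd (Nat.le_of_dvd (by omega) h) (by omega)
      have e : eval 1 (C (-((a + 1 : ℕ) : F)) * X * Q +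
          (X - 1) * (X * derivative Q - C (c (a + 1)) * Q)) = -((a + 1 : ℕ) : F) * Q.eval 1 := by
        simp
      rw [hcast, e]
      exact mul_ne_zero (neg_ne_zero.2 h) hQ1

/-- For c_l = -l no cofactor survives: with N + 1 = -(a + 1) in F, the operator X d/dX + (a + 1)
sends (X - 1)^(N+1) to -(a + 1)(X - 1)^N (X - (X - 1)). -/
lemma coeffPoly_neg {m a : ℕ} (han : a < p ^ m) :
    coeffPoly (fun l => -(l : F)) (p ^ m) a =
      C ((-1) ^ a * (a.factorial : F)) * (X - 1) ^ (p ^ m - 1 - a) := by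
  induction a with
  | zero => simp [coeffPoly, geom_sum_eq_X_sub_one_pow]
  | succ a ih =>
    obtain ⟨N, hN⟩ : ∃ N, p ^ m - 1 - a = N + 1 := ⟨p ^ m - 1 - (a + 1), by omega⟩
    have hcast := cast_pow_sub_one_sub (F := F) p han
    rw [hN] at hcast
    rw [coeffPoly_succ, ih (by omega), hN, show p ^ m - 1 - (a + 1) = N by omega, derivative_C_mul,
      derivative_pow, Nat.add_sub_cancel, derivative_sub, derivative_X, derivative_one, hcast,
      Nat.factorial_succ]
    push_cast
    simp only [C_mul, C_add, C_neg, C_pow, C_1]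
    ring

lemma pow_dvd_coeffPoly_and_not_dvd (c : ℕ → F) {m a : ℕ} (hap : a < p) (han : a < p ^ m) :
    (X - 1) ^ (p ^ m - a - 1) ∣ coeffPoly c (p ^ m) a ∧
      ¬ (X - 1) ^ (p ^ m - a) ∣ coeffPoly c (p ^ m) a := by
  obtain ⟨Q, hQ, hQ1⟩ := exists_coeffPoly_eq p c hap han
  have h0 : (X - 1 : F[X]) ≠ 0 := by simpa using X_sub_C_ne_zero (1 : F)
  rw [Nat.sub_right_comm] at hQ
  refine ⟨⟨Q, hQ⟩, ?_⟩
  obtain ⟨N, hN⟩ : ∃ N, p ^ m - a = N + 1 := ⟨p ^ m - a - 1, by omega⟩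
  rw [hQ, hN, Nat.add_sub_cancel, pow_succ,
    mul_dvd_mul_iff_left (pow_ne_zero _ h0), ← C_1, dvd_iff_isRoot]
  simpa [IsRoot] using hQ1

end Polynomials

/-! ### Divisibility and reindexing in F[X]/(X^n - 1). -/

section CyclicRing

variable {F : Type*} [Field F]

lemma mk_coeffPoly (c : ℕ → F) (g : F[X]) (n a : ℕ) :
    AdjoinRoot.mk g (coeffPoly c n a) = ∑ j ∈ Finset.range n,
      (∏ l ∈ Finset.Icc 1 a, ((j : F) - c l)) • AdjoinRoot.root g ^ j := by
  rw [coeffPoly, map_sum]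
  refine Finset.sum_congr rfl fun j _ => ?_
  rw [map_mul, map_pow, AdjoinRoot.mk_X, AdjoinRoot.mk_C, Algebra.smul_def]
  rfl

/-- A divisor of the modulus also divides any error made by lifting from the quotient. -/
lemma mk_dvd_mk_iff {f g q : F[X]} (h : q ∣ g) :
    AdjoinRoot.mk g q ∣ AdjoinRoot.mk g f ↔ q ∣ f := by
  refine ⟨?_, map_dvd _⟩
  rintro ⟨r, hr⟩
  obtain ⟨r, rfl⟩ := AdjoinRoot.mk_surjective r
  rw [← map_mul, AdjoinRoot.mk_eq_mk] at hr
  exact (dvd_sub_left (dvd_mul_right q r)).1 (h.trans hr)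

lemma sum_range_mul_of_periodic {M : Type*} [AddCommMonoid M] {g : ℕ → M} {n h : ℕ}
    (hg : ∀ j, g (j % n) = g j) (hn : 0 < n) (hcop : h.Coprime n) :
    ∑ i ∈ Finset.range n, g (h * i) = ∑ j ∈ Finset.range n, g j := by
  have hmaps : Set.MapsTo (fun i => h * i % n) (Finset.range n) (Finset.range n) :=
    fun i _ => by simpa using Nat.mod_lt _ hn
  have hinj : Set.InjOn (fun i => h * i % n) (Finset.range n) := by
    intro i hi j hj hij
    have h1 : i ≡ j [MOD n] := Nat.ModEq.cancel_left_of_coprime hcop.symm hij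
    simp only [Finset.coe_range, Set.mem_Iio] at hi hj
    rwa [Nat.ModEq, Nat.mod_eq_of_lt hi, Nat.mod_eq_of_lt hj] at h1
  refine Finset.sum_bij (fun i _ => h * i % n) (fun i hi => hmaps hi)
    (fun i hi j hj hij => hinj hi hj hij) ?_ (fun i _ => (hg _).symm)
  intro j hj
  obtain ⟨i, hi, hij⟩ := Finset.surjOn_of_injOn_of_card_le _ hmaps hinj le_rfl hj
  exact ⟨i, hi, hij⟩

/-- In a ring containing an `n`-th root of unity `x`, `n = p ^ m`, the sum
`∑ ∏ (j - l h) x ^ j` is a multiple of a power of `x ^ (-h) - 1`. -/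
lemma sum_prod_smul_pow_eq {R : Type*} [CommRing R] [Algebra F R] (p : ℕ) [Fact p.Prime]
    [CharP F p] {m a h : ℕ} (hm : m ≠ 0) (han : a < p ^ m) (hh : h.Coprime p) {x : R}
    (hx : x ^ p ^ m = 1) :
    ∑ j ∈ Finset.range (p ^ m), (∏ l ∈ Finset.Icc 1 a, ((j : F) - l * h)) • x ^ j =
      ((h : F) ^ a * (a.factorial : F)) • (Ring.inverse x ^ h - 1) ^ (p ^ m - a - 1) := by
  have hn : 0 < p ^ m := pow_pos (Fact.out : p.Prime).pos m
  have hn0 : ((p ^ m : ℕ) : F) = 0 := by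
    rw [Nat.cast_pow, CharP.cast_eq_zero F p, zero_pow hm]
  set n := p ^ m with hndef
  have hinv : Ring.inverse x = x ^ (n - 1) := by
    have h1 : x * x ^ (n - 1) = 1 := by rw [← pow_succ', Nat.sub_add_cancel hn, hx]
    exact Ring.inverse_unit (Units.mkOfMulEqOne _ _ h1)
  -- The natural number (n - 1)h stands for -h modulo n, and its multiples permute the residues
  -- modulo n.
  have hcop : ((n - 1) * h).Coprime n := by
    refine Nat.Coprime.mul_left ?_ (Nat.Coprime.pow_right _ hh)
    exact (Nat.coprime_self_sub_left hn).2 (Nat.coprime_one_left n)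
  have hcast : (((n - 1) * h : ℕ) : F) = -h := by
    rw [Nat.cast_mul, Nat.cast_sub hn, hn0]; simp
  have hper : ∀ j, (fun j : ℕ => (∏ l ∈ Finset.Icc 1 a, ((j : F) - l * h)) • x ^ j) (j % n) =
      (fun j : ℕ => (∏ l ∈ Finset.Icc 1 a, ((j : F) - l * h)) • x ^ j) j := by
    intro j
    have e1 : ((j % n : ℕ) : F) = j := by
      conv_rhs => rw [← Nat.mod_add_div j n, Nat.cast_add, Nat.cast_mul, hn0]
      simp
    have e2 : x ^ (j % n) = x ^ j := by
      conv_rhs => rw [← Nat.mod_add_div j n, pow_add, pow_mul, hx, one_pow, mul_one]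
    simp only [e1, e2]
  rw [← sum_range_mul_of_periodic hper hn hcop, hinv, ← pow_mul]
  set y := x ^ ((n - 1) * h) with hy
  have h2 := congrArg (aeval y) (coeffPoly_neg (F := F) p han)
  rw [← hndef, coeffPoly, map_sum] at h2
  simp only [map_mul, map_pow, aeval_C, aeval_X, map_sub, map_one] at h2
  -- At j = -hi each factor j - lh becomes -h(i + l), which is the case handled by `coeffPoly_neg`.
  have h3 : ∀ i : ℕ, ∏ l ∈ Finset.Icc 1 a, ((((n - 1) * h * i : ℕ) : F) - l * h) =
      (-(h : F)) ^ a * ∏ l ∈ Finset.Icc 1 a, ((i : F) - -(l : F)) := by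
    intro i
    rw [Nat.cast_mul, hcast]
    have : (-(h : F)) ^ a = ∏ l ∈ Finset.Icc 1 a, (-(h : F)) := by simp
    rw [this, ← Finset.prod_mul_distrib]
    exact Finset.prod_congr rfl fun l _ => by ring
  have h4 : ∀ i : ℕ, x ^ ((n - 1) * h * i) = y ^ i := fun i => pow_mul _ _ _
  simp only [h3, h4]
  simp only [Algebra.smul_def, map_mul, mul_assoc] at h2 ⊢
  rw [← Finset.mul_sum, h2, Nat.sub_right_comm]
  simp only [map_pow, map_neg, map_one, neg_pow ((algebraMap F R) h)]
  have : (-1 : R) ^ a * (-1) ^ a = 1 := by rw [← mul_pow]; simp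
  linear_combination ((algebraMap F R) h ^ a * (algebraMap F R) a.factorial *
    (y - 1) ^ (n - a - 1)) * this

end CyclicRing

/-! ### Separation of exponent tuples modulo p^a. -/

section Digits

/-- Uniqueness of `∑ m_i g_i` modulo `p ^ a` when the successive differences of the `g_i` have
`p`-adic valuations `1, 2, …`. -/
lemma eq_of_pow_dvd_sum {p : ℕ} (hp : p.Prime) : ∀ {a : ℕ} (g : Fin a → ℤ) (m m' : Fin a → ℕ),
    (∀ h : 0 < a, ¬ (p : ℤ) ∣ g ⟨0, h⟩) →
    (∀ (i : ℕ) (hi : i + 1 < a), ∃ s : ℤ, ¬ (p : ℤ) ∣ s ∧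
      g ⟨i + 1, hi⟩ - g ⟨i, Nat.lt_of_succ_lt hi⟩ = (p : ℤ) ^ (i + 1) * s) →
    ∑ i, m i < p → ∑ i, m' i < p → (p : ℤ) ^ a ∣ ∑ i, ((m i : ℤ) - m' i) * g i → m = m' := by
  intro a
  induction a with
  | zero => intros; exact Subsingleton.elim _ _
  | succ a ih =>
    intro g m m' h0 hs hm hm' hdvd
    have hp0 : (p : ℤ) ≠ 0 := by exact_mod_cast hp.ne_zero
    have hpg : ∀ (i : ℕ) (hi : i < a + 1), (p : ℤ) ∣ g ⟨i, hi⟩ - g 0 := by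
      intro i
      induction i with
      | zero => intro hi; exact ⟨0, by simp⟩
      | succ i ihi =>
        intro hi
        obtain ⟨s, -, hs⟩ := hs i hi
        have h1 : (p : ℤ) ∣ g ⟨i + 1, hi⟩ - g ⟨i, Nat.lt_of_succ_lt hi⟩ :=
          hs ▸ (dvd_pow_self _ (Nat.succ_ne_zero i)).mul_right s
        simpa using dvd_add h1 (ihi (Nat.lt_of_succ_lt hi))
    choose q hq using fun i : Fin a => hpg i.succ i.succ.2
    have hsplit : ∑ i, ((m i : ℤ) - m' i) * g i = ((∑ i, m i : ℕ) - (∑ i, m' i : ℕ) : ℤ) * g 0 +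
        p * ∑ i : Fin a, ((m i.succ : ℤ) - m' i.succ) * q i := by
      have h1 : ∀ i : Fin a, g i.succ = g 0 + p * q i := fun i => by
        rw [← hq i, add_sub_cancel]
      rw [Fin.sum_univ_succ, Fin.sum_univ_succ, Fin.sum_univ_succ]
      simp only [h1]
      push_cast
      rw [Finset.mul_sum]
      simp only [mul_add, sub_mul, add_mul, Finset.sum_add_distrib, Finset.sum_sub_distrib,
        Finset.sum_mul, mul_sub, mul_left_comm (p : ℤ)]
      ring
    -- All g_i agree with g_0 modulo p and g_0 is invertible there, so the sums agree modulo p. Both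
    -- being less than p, they are equal.
    have hsum : ∑ i, m i = ∑ i, m' i := by
      have h1 : (p : ℤ) ∣ ((∑ i, m i : ℕ) - (∑ i, m' i : ℕ) : ℤ) * g 0 := by
        have h2 := (dvd_pow_self (p : ℤ) (Nat.succ_ne_zero a)).trans hdvd
        rw [hsplit] at h2
        exact (dvd_add_left (dvd_mul_right _ _)).1 h2
      have h2 := ((Nat.prime_iff_prime_int.1 hp).dvd_or_dvd h1).resolve_right (h0 a.succ_pos)
      have h3 : ∑ i, m' i ≡ ∑ i, m i [MOD p] := Nat.modEq_iff_dvd.2 h2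
      rw [Nat.ModEq, Nat.mod_eq_of_lt hm, Nat.mod_eq_of_lt hm'] at h3
      exact h3.symm
    -- With equal sums the g_0 term drops out and one factor p cancels. The quotients q_i = (g_(i+1)
    -- - g_0)/p satisfy the same hypotheses with one entry fewer.
    have htail : (fun i : Fin a => m i.succ) = fun i : Fin a => m' i.succ := by
      refine ih q _ _ ?_ ?_ ?_ ?_ ?_
      · intro ha
        obtain ⟨s, hsp, hs⟩ := hs 0 (by omega)
        have h1 := hq ⟨0, ha⟩
        have h2 : (p : ℤ) * q ⟨0, ha⟩ = p * s := by
          rw [← h1]; simpa using hs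
        rwa [mul_left_cancel₀ hp0 h2]
      · intro i hi
        obtain ⟨s, hsp, hs⟩ := hs (i + 1) (by omega)
        refine ⟨s, hsp, mul_left_cancel₀ hp0 ?_⟩
        rw [mul_sub, ← hq, ← hq, ← mul_assoc, ← pow_succ', ← hs]
        simp
      · rw [Fin.sum_univ_succ] at hm; omega
      · rw [Fin.sum_univ_succ] at hm'; omega
      · rw [hsplit, hsum, sub_self, zero_mul, zero_add, pow_succ'] at hdvd
        exact (mul_dvd_mul_iff_left hp0).1 hdvd
    have hhead : m 0 = m' 0 := by
      rw [Fin.sum_univ_succ, Fin.sum_univ_succ] at hsum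
      have h1 := congrArg (fun f : Fin a → ℕ => ∑ i, f i) htail
      omega
    ext i
    refine Fin.cases hhead (fun i => congrFun htail i) i

end Digits

/-! ### Leading terms of products of the σ_i - 1. -/

section ListProducts

variable {O OK k K : Type*}
    [CommRing O] [IsDomain O] [IsDiscreteValuationRing O]
    [CommRing OK] [IsDomain OK] [IsDiscreteValuationRing OK]
    [Field k] [Field K] [Algebra O k] [IsFractionRing O k] [Algebra OK K] [IsFractionRing OK K]
    [Algebra k K] [FiniteDimensional k K] [IsGalois k K]
    [Algebra O OK] [Algebra O K] [IsScalarTower O OK K] [IsScalarTower O k K]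
    [IsIntegralClosure OK O K] [Module.IsTorsionFree O OK]
    (p : ℕ) [Fact p.Prime] [CharP (ResidueField OK) p]

variable (O k K) in
lemma wild_of_totallyRamified (hram : TotallyRamified O OK k K)
    (hdeg : ∃ m : ℕ, Module.finrank k K = p ^ m) {ϖ : OK} (hϖ : Irreducible ϖ) : Wild k K ϖ := by
  obtain ⟨m, hm⟩ := hdeg
  intro σ
  refine valGE_one_of_pow_eq_one (galoisIsometric O OK k K) (residueRep hram) hϖ p (m := m) ?_
  rw [← hm, ← IsGalois.card_aut_eq_finrank]
  exact pow_card_eq_one'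

/-- The sum of the jumps of the members of a list. -/
noncomputable def jumpSum (OK : Type*) {k K : Type*} [CommRing OK] [IsDomain OK]
    [IsDiscreteValuationRing OK] [Field k] [Field K] [Algebra k K] [Algebra OK K]
    [IsFractionRing OK K] (L : List Gal(K/k)) : ℤ :=
  (L.map fun σ => (jump OK σ : ℤ)).sum

/-- A nonempty list of nontrivial elements forces n > 1, hence n ≥ p. In particular the truncated
exponents n - a and n - a - 1 are genuine differences. -/
lemma length_lt_finrank {m : ℕ} (hm : Module.finrank k K = p ^ m)
    {L : List Gal(K/k)} (hL : ∀ σ ∈ L, σ ≠ 1) (hLp : L.length < p) :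
    L.length < p ^ m := by
  cases L with
  | nil => exact pow_pos (Fact.out : p.Prime).pos m
  | cons σ L =>
    have hm0 : m ≠ 0 := by
      rintro rfl
      have hσ := hL σ List.mem_cons_self
      rw [pow_zero, ← IsGalois.card_aut_eq_finrank, Nat.card_eq_one_iff_unique] at hm
      exact hσ (@Subsingleton.elim _ hm.1 _ _)
    exact hLp.trans_le (Nat.le_self_pow hm0 p)

lemma jumpResidue_eq_zero_of_finrank_eq_one (h : Module.finrank k K = 1) :
    jumpResidue OK k K p = 0 := by
  rw [← IsGalois.card_aut_eq_finrank, Nat.card_eq_one_iff_unique] at h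
  have hs : {h : ℕ | ∃ σ : Gal(K/k), σ ≠ 1 ∧ jump OK σ = h} = ∅ := by
    refine Set.eq_empty_of_forall_notMem ?_
    rintro _ ⟨σ, hσ, -⟩
    exact hσ (@Subsingleton.elim _ h.1 _ _)
  rw [jumpResidue, hs, Nat.sInf_empty, Nat.zero_mod]

section

variable (hram : TotallyRamified O OK k K) (hdeg : ∃ m : ℕ, Module.finrank k K = p ^ m)
    {ϖ : OK} (hϖ : Irreducible ϖ)
include hram hdeg hϖ

lemma exists_hasLead_listProd {L : List Gal(K/k)} (hL : ∀ σ ∈ L, σ ≠ 1) :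
    ∃ c : ResidueField OK, c ≠ 0 ∧
      HasLead ϖ (groupAlgebraEnd k K (listProd L)) (jumpSum OK L) fun j =>
        c * ∏ l ∈ Finset.Icc 1 L.length, (((j + jumpSum OK L : ℤ) : ResidueField OK) -
          l * (jumpResidue OK k K p : ResidueField OK)) := by
  have hG := galoisIsometric O OK k K
  have hR := residueRep hram
  have hw := wild_of_totallyRamified O k K p hram hdeg hϖ
  rw [groupAlgebraEnd_listProd]
  exact exists_hasLead_list_prod hG hR hϖ hw
    (fun τ hτ => jump_cast_eq_jumpResidue hG hR hϖ hw p hτ) L hL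

lemma exists_pmap_listProd_eq {L : List Gal(K/k)} (hL : ∀ σ ∈ L, σ ≠ 1) :
    ∃ c : ResidueField OK, c ≠ 0 ∧
      pmap O ϖ (jumpSum OK L) (incl k K (listProd L)) = c • AdjoinRoot.mk _
        (coeffPoly (fun l => l * (jumpResidue OK k K p : ResidueField OK))
          (Module.finrank k K) L.length) := by
  obtain ⟨c, hc, h⟩ := exists_hasLead_listProd p hram hdeg hϖ hL
  refine ⟨_, mul_ne_zero (inv_ne_zero (res_trace_ne_zero O k hram hϖ)) hc, ?_⟩
  rw [h.pmap_eq, mk_coeffPoly, mul_smul]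
  congr 1
  rw [Finset.smul_sum]
  refine Finset.sum_congr rfl fun j _ => ?_
  rw [smul_smul, sub_add_cancel, Int.cast_natCast]

lemma simR_pmap_listProd {L : List Gal(K/k)} (hL : ∀ σ ∈ L, σ ≠ 1) :
    SimR (pmap O ϖ (jumpSum OK L) (incl k K (listProd L)))
      (∑ j ∈ Finset.range (Module.finrank k K), (∏ l ∈ Finset.Icc 1 L.length,
        ((j : ResidueField OK) - (l : ResidueField OK) *
          (jumpResidue OK k K p : ResidueField OK))) • XX OK k K ^ j) := by
  obtain ⟨c, hc, h⟩ := exists_pmap_listProd_eq p hram hdeg hϖ hL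
  exact ⟨c, hc, by rw [h, mk_coeffPoly]⟩

lemma pow_dvd_pmap_listProd {L : List Gal(K/k)} (hL : ∀ σ ∈ L, σ ≠ 1) (hLp : L.length < p) :
    (XX OK k K - 1) ^ (Module.finrank k K - L.length - 1) ∣
        pmap O ϖ (jumpSum OK L) (incl k K (listProd L)) ∧
      ¬ (XX OK k K - 1) ^ (Module.finrank k K - L.length) ∣
        pmap O ϖ (jumpSum OK L) (incl k K (listProd L)) := by
  obtain ⟨c, hc, h⟩ := exists_pmap_listProd_eq p hram hdeg hϖ hL
  obtain ⟨m, hm⟩ := hdeg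
  have hlt := length_lt_finrank p hm hL hLp
  have hc' : IsUnit (algebraMap (ResidueField OK) (RR OK k K) c) := hc.isUnit.map _
  have hX : ∀ e : ℕ, (XX OK k K - 1) ^ e = AdjoinRoot.mk _ ((X - 1) ^ e) := fun e => by
    rw [map_pow, map_sub, AdjoinRoot.mk_X, map_one]
  have hg : (X : (ResidueField OK)[X]) ^ Module.finrank k K - 1 =
      (X - 1) ^ Module.finrank k K := by
    rw [hm, sub_pow_char_pow, one_pow]
  -- The modulus X^n - 1 is (X - 1)^n in characteristic p, so for e ≤ n divisibility by (X - 1)^e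
  -- can be tested on polynomials.
  have hdvd : ∀ e ≤ Module.finrank k K, (XX OK k K - 1) ^ e ∣
      pmap O ϖ (jumpSum OK L) (incl k K (listProd L)) ↔ (X - 1) ^ e ∣
        coeffPoly (fun l => l * (jumpResidue OK k K p : ResidueField OK))
          (Module.finrank k K) L.length := by
    intro e he
    rw [h, Algebra.smul_def, hc'.dvd_mul_left, hX, mk_dvd_mk_iff]
    exact hg ▸ pow_dvd_pow _ he
  rw [hdvd _ (by omega), hdvd _ (by omega), hm]
  exact pow_dvd_coeffPoly_and_not_dvd p _ hLp hlt

lemma pmap_listProd_ne_zero {L : List Gal(K/k)} (hL : ∀ σ ∈ L, σ ≠ 1) (hLp : L.length < p) :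
    pmap O ϖ (jumpSum OK L) (incl k K (listProd L)) ≠ 0 := fun h =>
  (pow_dvd_pmap_listProd p hram hdeg hϖ hL hLp).2 (h ▸ dvd_zero _)

lemma level_listProd {L : List Gal(K/k)} (hL : ∀ σ ∈ L, σ ≠ 1) (hLp : L.length < p) :
    level (OK := OK) (incl k K (listProd L)) = jumpSum OK L ∧ incl k K (listProd L) ≠ 0 := by
  obtain ⟨c, hc, h⟩ := exists_hasLead_listProd p hram hdeg hϖ hL
  have hne := pmap_listProd_ne_zero p hram hdeg hϖ hL hLp
  rw [h.pmap_eq] at hne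
  obtain ⟨j, -, hj⟩ := Finset.exists_ne_zero_of_sum_ne_zero (right_ne_zero_of_smul hne)
  have hj := left_ne_zero_of_smul hj
  refine ⟨h.level_eq hϖ hj, fun h0 => hj ?_⟩
  rw [← h.res_eq, ← act_incl, h0]
  simp [act, res_zero]

lemma simR_pmap_listProd_pow {L : List Gal(K/k)} (hL : ∀ σ ∈ L, σ ≠ 1) (hLp : L.length < p)
    (hres : jumpResidue OK k K p ≠ 0) :
    SimR (pmap O ϖ (jumpSum OK L) (incl k K (listProd L)))
      ((Ring.inverse (XX OK k K) ^ jumpResidue OK k K p - 1) ^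
        (Module.finrank k K - L.length - 1)) := by
  obtain ⟨c, hc, h⟩ := simR_pmap_listProd p hram hdeg hϖ hL
  obtain ⟨m, hm⟩ := hdeg
  have hp : p.Prime := Fact.out
  have hm0 : m ≠ 0 := by
    -- For n = 1 there are no jumps, so `jumpResidue` takes its default value 0.
    rintro rfl
    exact hres (jumpResidue_eq_zero_of_finrank_eq_one p (by rw [hm, pow_zero]))
  have hnd : ¬ p ∣ jumpResidue OK k K p := fun hd =>
    absurd (Nat.le_of_dvd (Nat.pos_of_ne_zero hres) hd) (Nat.mod_lt _ hp.pos).not_ge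
  have hx : XX OK k K ^ p ^ m = 1 := by
    have := AdjoinRoot.mk_self (f := (X : (ResidueField OK)[X]) ^ Module.finrank k K - 1)
    rw [map_sub, map_pow, AdjoinRoot.mk_X, map_one, sub_eq_zero] at this
    rwa [← hm]
  have hsum := sum_prod_smul_pow_eq (F := ResidueField OK) p hm0 (length_lt_finrank p hm hL hLp)
    ((Nat.Prime.coprime_iff_not_dvd hp).2 hnd).symm hx
  rw [← hm] at hsum
  refine ⟨c * ((jumpResidue OK k K p : ResidueField OK) ^ L.length *
    (L.length.factorial : ResidueField OK)), ?_, ?_⟩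
  · refine mul_ne_zero hc (mul_ne_zero (pow_ne_zero _ ?_) ?_) <;>
      rw [Ne, CharP.cast_eq_zero_iff (ResidueField OK) p]
    · exact hnd
    · rw [hp.dvd_factorial]; omega
  · rw [h, hsum, smul_smul]

end

end ListProducts

/-! ### Graded independence of the small products. -/

section GradedIndependence

variable {O OK k K : Type*}
    [CommRing O] [IsDomain O] [IsDiscreteValuationRing O]
    [CommRing OK] [IsDomain OK] [IsDiscreteValuationRing OK]
    [Field k] [Field K] [Algebra O k] [IsFractionRing O k] [Algebra OK K] [IsFractionRing OK K]
    [Algebra k K] [FiniteDimensional k K] [IsGalois k K]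
    [Algebra O OK] [Algebra O K] [IsScalarTower O OK K] [IsScalarTower O k K]
    [IsIntegralClosure OK O K] [Module.IsTorsionFree O OK]
    (p : ℕ) [Fact p.Prime] [CharP (ResidueField OK) p]

/-- The products `(σ_1 - 1)^(m_1) ⋯ (σ_a - 1)^(m_a)` with `∑ m_i < p`. -/
def smallProducts {k K : Type*} [Field k] [Field K] [Algebra k K] (p : ℕ) {a : ℕ}
    (σ : Fin a → Gal(K/k)) : Set (MonoidAlgebra K Gal(K/k)) :=
  {f | ∃ m : Fin a → ℕ, ∑ i, m i < p ∧ f = incl k K (prodPow σ m)}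

lemma gradedIndependent_smallProducts (hram : TotallyRamified O OK k K)
    (hdeg : ∃ m : ℕ, Module.finrank k K = p ^ m) {ϖ : OK} (hϖ : Irreducible ϖ)
    {a : ℕ} (σ : Fin a → Gal(K/k)) (hσ : ∀ i, σ i ≠ 1) (hpa : p ^ a ≤ Module.finrank k K)
    (hres : jumpResidue OK k K p ≠ 0)
    (hdiff : ∀ (i : ℕ) (hi : i + 1 < a), ∃ s : ℤ, ¬ (p : ℤ) ∣ s ∧
        (jump OK (σ ⟨i + 1, hi⟩) : ℤ) - (jump OK (σ ⟨i, Nat.lt_of_succ_lt hi⟩) : ℤ) =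
          (p : ℤ) ^ (i + 1) * s) :
    (∀ s : ℤ, (slice O OK (smallProducts p σ) s).Subsingleton) ∧
      GradedIndependent O ϖ (smallProducts p σ) := by
  have hp : p.Prime := Fact.out
  have hL : ∀ m : Fin a → ℕ,
      ∀ τ ∈ (List.ofFn fun i => List.replicate (m i) (σ i)).flatten, τ ≠ 1 := by
    intro m τ hτ
    obtain ⟨l, hl, hτ⟩ := List.mem_flatten.1 hτ
    obtain ⟨i, rfl⟩ := List.mem_ofFn.1 hl
    rw [List.eq_of_mem_replicate hτ]
    exact hσ i
  have hlen : ∀ m : Fin a → ℕ,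
      (List.ofFn fun i => List.replicate (m i) (σ i)).flatten.length = ∑ i, m i := by
    intro m
    rw [List.length_flatten, List.map_ofFn, List.sum_ofFn]
    simp
  have hjsum : ∀ m : Fin a → ℕ,
      jumpSum OK (List.ofFn fun i => List.replicate (m i) (σ i)).flatten =
        ∑ i, (m i : ℤ) * jump OK (σ i) := by
    intro m
    rw [jumpSum, List.map_flatten, List.sum_flatten, List.map_map, List.map_ofFn, List.sum_ofFn]
    simp
  have hlevel := fun (m : Fin a → ℕ) (hm : ∑ i, m i < p) =>
    level_listProd p hram hdeg hϖ (hL m) (by rwa [hlen m])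
  have hsub : ∀ s : ℤ, (slice O OK (smallProducts p σ) s).Subsingleton := by
    rintro s _ ⟨⟨m, hm, rfl⟩, h1⟩ _ ⟨⟨m', hm', rfl⟩, h2⟩
    have h3 := h1.trans h2.symm
    rw [dfun, dfun, prodPow_eq_listProd, prodPow_eq_listProd, (hlevel m hm).1, (hlevel m' hm').1,
      hjsum, hjsum] at h3
    have h4 := h3.symm.dvd
    rw [sub_sub_sub_cancel_right, ← Finset.sum_sub_distrib] at h4
    -- Since n is a power of p with n ≥ p^a, a congruence modulo n implies one modulo p^a.
    have hpn : (p : ℤ) ^ a ∣ (Module.finrank k K : ℤ) := by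
      obtain ⟨r, hr⟩ := hdeg
      rw [hr] at hpa ⊢
      exact_mod_cast pow_dvd_pow p ((Nat.pow_le_pow_iff_right hp.one_lt).1 hpa)
    have h5 : m = m' := by
      refine eq_of_pow_dvd_sum hp (fun i => (jump OK (σ i) : ℤ)) m m' ?_ hdiff hm hm' ?_
      · intro h0 hd
        have h6 := jump_modEq_jumpResidue (galoisIsometric O OK k K) (residueRep hram) hϖ
          (wild_of_totallyRamified O k K p hram hdeg hϖ) p (hσ ⟨0, h0⟩)
        rw [Int.natCast_dvd_natCast] at hd
        rw [Nat.ModEq, Nat.mod_eq_zero_of_dvd hd, jumpResidue, Nat.mod_mod] at h6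
        exact hres h6.symm
      · refine hpn.trans ?_
        simpa only [sub_mul] using h4
    rw [h5]
  refine ⟨hsub, ?_, fun s => ?_⟩
  · rintro ⟨m, hm, h⟩
    rw [prodPow_eq_listProd] at h
    exact (hlevel m hm).2 h.symm
  -- A family with at most one member is independent as soon as its member is nonzero.
  · have : Subsingleton (slice O OK (smallProducts p σ) s) := (hsub s).coe_sort
    refine linearIndependent_subsingleton_index_iff _ |>.2 ?_
    rintro ⟨_, ⟨m, hm, rfl⟩, -⟩
    simp only [prodPow_eq_listProd]
    rw [lead, (hlevel m hm).1]
    exact pmap_listProd_ne_zero p hram hdeg hϖ (hL m) (by rwa [hlen m])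

end GradedIndependence

end AssocGalois

open AssocGalois in
theorem mainTheorem4 {O OK k K : Type*}
    [CommRing O] [IsDomain O] [IsDiscreteValuationRing O]
    [IsAdicComplete (IsLocalRing.maximalIdeal O) O]
    [CommRing OK] [IsDomain OK] [IsDiscreteValuationRing OK]
    [Field k] [Field K] [Algebra O k] [IsFractionRing O k] [Algebra OK K] [IsFractionRing OK K]
    [Algebra k K] [FiniteDimensional k K] [IsGalois k K]
    [Algebra O OK] [Algebra O K] [IsScalarTower O OK K] [IsScalarTower O k K]
    [IsIntegralClosure OK O K] [Module.IsTorsionFree O OK]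
    (p : ℕ) [Fact p.Prime] [CharP (IsLocalRing.ResidueField OK) p]
    (hram : TotallyRamified O OK k K)
    (hdeg : ∃ m : ℕ, Module.finrank k K = p ^ m)
    (ϖ : OK) (hϖ : Irreducible ϖ)
    (a : ℕ) (σ : Fin a → Gal(K/k)) (hσ : ∀ i, σ i ≠ 1) :
    -- `jumpResidue` is the common residue of all ramification jumps
    (∀ τ : Gal(K/k), τ ≠ 1 → jump OK τ ≡ jumpResidue OK k K p [MOD p]) ∧
    -- part 1
    (prodSub σ ∈ modA OK k K (∑ i, (jump OK (σ i) : ℤ)) ∧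
      SimR (pmap O ϖ (∑ i, (jump OK (σ i) : ℤ)) (incl k K (prodSub σ)))
        (∑ j ∈ Finset.range (Module.finrank k K),
          (∏ l ∈ Finset.Icc 1 a, ((j : IsLocalRing.ResidueField OK) -
            (l : IsLocalRing.ResidueField OK) *
              (jumpResidue OK k K p : IsLocalRing.ResidueField OK))) • XX OK k K ^ j)) ∧
    -- part 2
    (a < p →
      (XX OK k K - 1) ^ (Module.finrank k K - a - 1) ∣
        pmap O ϖ (∑ i, (jump OK (σ i) : ℤ)) (incl k K (prodSub σ)) ∧
      ¬ (XX OK k K - 1) ^ (Module.finrank k K - a) ∣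
        pmap O ϖ (∑ i, (jump OK (σ i) : ℤ)) (incl k K (prodSub σ)) ∧
      prodSub σ ≠ 0 ∧
      dfun O OK (incl k K (prodSub σ)) =
        (∑ i, (jump OK (σ i) : ℤ)) - ramDepth O OK k K ∧
      (jumpResidue OK k K p ≠ 0 →
        SimR (pmap O ϖ (∑ i, (jump OK (σ i) : ℤ)) (incl k K (prodSub σ)))
          ((Ring.inverse (XX OK k K) ^ jumpResidue OK k K p - 1) ^
            (Module.finrank k K - a - 1)))) ∧
    -- part 3
    (p ^ a ≤ Module.finrank k K → jumpResidue OK k K p ≠ 0 →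
      (∀ (i : ℕ) (hi : i + 1 < a), ∃ s : ℤ, ¬ (p : ℤ) ∣ s ∧
        (jump OK (σ ⟨i + 1, hi⟩) : ℤ) - (jump OK (σ ⟨i, Nat.lt_of_succ_lt hi⟩) : ℤ) =
          (p : ℤ) ^ (i + 1) * s) →
      (∀ s : ℤ, (slice O OK {f : MonoidAlgebra K Gal(K/k) |
        ∃ m : Fin a → ℕ, ∑ i, m i < p ∧ f = incl k K (prodPow σ m)} s).Subsingleton) ∧
      GradedIndependent O ϖ {f : MonoidAlgebra K Gal(K/k) |
        ∃ m : Fin a → ℕ, ∑ i, m i < p ∧ f = incl k K (prodPow σ m)}) := by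
  have hG := galoisIsometric O OK k K
  have hR := residueRep hram
  have hw := wild_of_totallyRamified O k K p hram hdeg hϖ
  have hL : ∀ τ ∈ List.ofFn σ, τ ≠ 1 := by
    intro τ hτ
    obtain ⟨i, rfl⟩ := List.mem_ofFn.1 hτ
    exact hσ i
  have hlen : (List.ofFn σ).length = a := List.length_ofFn
  have hsum : jumpSum OK (List.ofFn σ) = ∑ i, (jump OK (σ i) : ℤ) := by
    rw [jumpSum, List.map_ofFn, List.sum_ofFn]; rfl
  refine ⟨fun τ hτ => jump_modEq_jumpResidue hG hR hϖ hw p hτ, ?_, fun hap => ?_, ?_⟩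
  · rw [prodSub_eq_listProd, ← hsum]
    obtain ⟨c, hc, h⟩ := exists_hasLead_listProd p hram hdeg hϖ hL
    have h2 := simR_pmap_listProd p hram hdeg hϖ hL
    rw [hlen] at h2
    exact ⟨h.mem_modA, h2⟩
  · rw [prodSub_eq_listProd, ← hsum]
    have hap' : (List.ofFn σ).length < p := by rwa [hlen]
    have h1 := pow_dvd_pmap_listProd p hram hdeg hϖ hL hap'
    have h2 := level_listProd p hram hdeg hϖ hL hap'
    have h3 := simR_pmap_listProd_pow p hram hdeg hϖ hL hap'
    rw [hlen] at h1 h3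
    refine ⟨h1.1, h1.2, fun h => h2.2 (by rw [h, map_zero]), ?_, h3⟩
    rw [dfun, h2.1]
  · intro hpa hres hdiff
    exact gradedIndependent_smallProducts p hram hdeg hϖ σ hσ hpa hres hdiff
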